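/- Let $k\ge 1$ and $n\ge k+1$ be integers. A $k$-tree is either a complete graph on $k$ vertices or a graph obtained from a smaller $k$-tree by adjoining a new vertex together with $k$ edges joining it to the vertices of a $k$-clique. For a graph $G$ with diagonal degree matrix $D(G)$ and adjacency matrix $A(G)$, let $q_1(G)$, the signless Laplacian index of $G$, be the largest eigenvalue of $Q(G)=D(G)+A(G)$. Let $S_{k,n-k}$ be the graph formed by a $k$-clique $v_1,\dots,v_k$ and $n-k$ pairwise non-adjacent vertices $u_1,\dots,u_{n-k}$, each joined to all of $v_1,\dots,v_k$. Let $G_1=S_{k,n-k}-u_1v_k+u_1u_2$ and $G_2=G_1-u_3v_k+u_3u_2$ (edges with an end $u_j$, $j>n-k$, being disregarded). (a) If $G$ is an $n$-vertex $k$-tree with $G\not\cong S_{k,n-k}$ and $G\not\cong G_1$, then $q_1(G)\le q_1(G_2)$, with equality if and only if $G\cong G_2$. (For $n\le k+3$ no such $G$ exists.) (b) If $n\ge k+5$, then $S_{k,n-k}$, $G_1$ and $G_2$ are $k$-trees, $G_2$ is isomorphic to neither $S_{k,n-k}$ nor $G_1$, and $q_1(G_2)<q_1(G_1)<q_1(S_{k,n-k})$;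 hence, by (a), $q_1(G_2)$ is the third largest value of the signless Laplacian index among all $n$-vertex $k$-trees, and $G_2$ is, up to isomorphism, the only $n$-vertex $k$-tree attaining it. -/

import Mathlib

universe u

namespace KTreeIndex

/-- `IsKTree k G` says that `G` is a `k`-tree: either `G` is a complete graph on `k` vertices, or
`G` arises from a smaller `k`-tree (here the graph `G - v`) by adjoining a new vertex `v` whose
neighbourhood is a `k`-clique of that smaller graph. -/
inductive IsKTree (k : ℕ) : {V : Type u} → SimpleGraph V → Prop
  | complete {V : Type u} [Finite V] (G : SimpleGraph V) (hV : Nat.card V = k) (hG : G = ⊤) :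
      IsKTree k G
  | adjoin {V : Type u} (G : SimpleGraph V) (v : V) (s : Finset V)
      (hs : G.IsNClique k s) (hN : G.neighborSet v = (s : Set V))
      (h : IsKTree k (G.induce ({v}ᶜ : Set V))) : IsKTree k G

open Classical in
/-- The signless Laplacian matrix `Q(G) = D(G) + A(G)`. -/
noncomputable def signlessLaplacian {V : Type*} [Fintype V] (G : SimpleGraph V) :
    Matrix V V ℝ :=
  G.degMatrix ℝ + G.adjMatrix ℝ

open Classical in
/-- The signless Laplacian index `q₁(G)`: the largest eigenvalue of `Q(G)`. -/
noncomputable def signlessIndex {V : Type*} [Fintype V] (G : SimpleGraph V) : ℝ :=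
  sSup (spectrum ℝ (signlessLaplacian G))

theorem isHermitian_signlessLaplacian {V : Type*} [Fintype V] (G : SimpleGraph V) :
    (signlessLaplacian G).IsHermitian := by
  classical
  exact (G.isHermitian_degMatrix ℝ).add (G.isHermitian_adjMatrix ℝ)

open Classical in
/-- The supremum defining `signlessIndex` is attained: it is the largest eigenvalue. -/
theorem isGreatest_signlessIndex {V : Type*} [Fintype V] [Nonempty V] (G : SimpleGraph V) :
    IsGreatest (spectrum ℝ (signlessLaplacian G)) (signlessIndex G) := by
  have h := (isHermitian_signlessLaplacian G).spectrum_real_eq_range_eigenvalues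
  have hne : (spectrum ℝ (signlessLaplacian G)).Nonempty := h ▸ Set.range_nonempty _
  have hfin : (spectrum ℝ (signlessLaplacian G)).Finite := h ▸ Set.finite_range _
  exact ⟨hne.csSup_mem hfin, fun x hx => le_csSup hfin.bddAbove hx⟩

/-- The graph on `{0, …, n-1}` whose only edge joins `i` and `j` (no edge at all if `i = j`, or if
`i` or `j` is not smaller than `n`). -/
def oneEdge (n i j : ℕ) : SimpleGraph (Fin n) :=
  SimpleGraph.fromRel fun a b => a.val = i ∧ b.val = j

/-- The `k`-star `S_{k,n-k}`: a `k`-clique `v₁, …, v_k`, all of whose vertices are joined to all of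
`n - k` pairwise non-adjacent vertices `u₁, …, u_{n-k}`. Here and below the vertex `v_i` is
`i - 1` and the vertex `u_j` is `k + j - 1`. -/
def kStar (k n : ℕ) : SimpleGraph (Fin n) :=
  SimpleGraph.fromRel fun a _ => a.val < k

/-- `G₁ = S_{k,n-k} - u₁v_k + u₁u₂`. -/
def graphG1 (k n : ℕ) : SimpleGraph (Fin n) :=
  (kStar k n \ oneEdge n k (k - 1)) ⊔ oneEdge n k (k + 1)

/-- `G₂ = G₁ - u₃v_k + u₃u₂`. -/
def graphG2 (k n : ℕ) : SimpleGraph (Fin n) :=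
  (graphG1 k n \ oneEdge n (k + 2) (k - 1)) ⊔ oneEdge n (k + 2) (k + 1)

end KTreeIndex

open KTreeIndex

/-!
The proof compares quadratic forms after sorting the vertices. Let `x` be the positive eigenvector
of a `k`-tree `G` for `q₁(G)` (`exists_isPerron`), and label the vertices by `Fin n` so that `x` is
antitone (`exists_sorted`). The sum of `(x u + x v) ^ 2` over the edges of `G` equals `q₁(G)` times
the squared norm of `x`, and for any other graph `H` the sum over its edges is at most `q₁(H)` times
the squared norm; `energy` is twice this sum.

Compare `G` with the `k`-star whose core consists of the first `k` vertices. Any `m` vertices of a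
`k`-tree span at most as many edges as the first `m` vertices of the star, with equality for `m = n`
(`IsKTree.adjCount_le_and_eq`). Summation by parts therefore matches the edges of the star that are
missing in `G` with the extra edges of `G`, and each extra edge with larger end `j` costs at least
`(x p + x j) ^ 2 - (x c + x j) ^ 2`, where `p` is the last vertex of the core and `c` the vertex
after it (`IsKTree.energy_le_kStar`).

* Without extra edges `G` is the `k`-star.
* If the extra edges share their larger end `j`, there is only one of them. Otherwise, as `G` has no
  induced four-cycle and as many missing as extra edges, some smaller end `i` has its neighbours
  among those of `j`, which forces `x i < x j` against the order (`extraPairs_eq_singleton`). With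
  one extra edge, `G` is the second graph (`iso_graphG1_of_extraPairs_eq_singleton`).
* Two distinct larger ends cost at least as much as the two smallest vertices, and replacing the
  edges from `p` to these by edges from `c` gives a copy of the third graph
  (`energy_add_slack_le_broom`). In case of equality `x` is an eigenvector of that copy as well, and
  `G` is found to be the join of a clique with a double star (`eq_broom_of_isPerron`).

The three extremal graphs are such joins, called brooms here. For brooms with the same number of
vertices and of hubs the index strictly increases as the double star gets more unbalanced
(`IsBroomData.signlessIndex_lt`), which settles the equality case and the strict order of the three
indices.
-/

universe v

namespace KTreeIndex

/-! ### The quadratic form and the positive eigenvector -/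

open Classical in
/-- The quadratic form `∑ (x u + x v) ^ 2` of a graph, summed over ordered adjacent pairs, so that
it is twice the quadratic form of the signless Laplacian. -/
noncomputable def energy {V : Type*} [Fintype V] (G : SimpleGraph V) (x : V → ℝ) : ℝ :=
  ∑ u, ∑ v, if G.Adj u v then (x u + x v) ^ 2 else 0

open Classical in
/-- The `v`-th coordinate of `Q(G) x`. -/
noncomputable def rowSum {V : Type*} [Fintype V] (G : SimpleGraph V) (x : V → ℝ) (v : V) : ℝ :=
  ∑ w, if G.Adj v w then x v + x w else 0

section Spectral

variable {V : Type*} [Fintype V]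

open Matrix in
theorem signlessLaplacian_mulVec (G : SimpleGraph V) (x : V → ℝ) (v : V) :
    (signlessLaplacian G *ᵥ x) v = rowSum G x v := by
  classical
  unfold signlessLaplacian rowSum
  rw [Matrix.add_mulVec, Pi.add_apply, SimpleGraph.degMatrix, Matrix.mulVec_diagonal]
  rw [SimpleGraph.adjMatrix_mulVec_apply, ← Finset.sum_filter]
  rw [Finset.sum_add_distrib, Finset.sum_const, nsmul_eq_mul]
  rw [← SimpleGraph.neighborFinset_eq_filter G, SimpleGraph.card_neighborFinset_eq_degree]

theorem energy_eq_sum_rowSum (G : SimpleGraph V) (x : V → ℝ) :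
    energy G x = 2 * ∑ v, x v * rowSum G x v := by
  classical
  unfold energy rowSum
  have h1 : ∀ u v, (if G.Adj u v then (x u + x v) ^ 2 else 0)
      = x u * (if G.Adj u v then x u + x v else 0)
        + x v * (if G.Adj v u then x v + x u else 0) := by
    intro u v
    rw [G.adj_comm v u]
    split_ifs <;> ring
  simp_rw [h1, Finset.sum_add_distrib]
  rw [Finset.sum_comm (f := fun u v => x v * (if G.Adj v u then x v + x u else 0))]
  simp_rw [← Finset.mul_sum]
  ring

open Matrix in
theorem posSemidef_signlessIndex_sub [Nonempty V] [DecidableEq V] (G : SimpleGraph V) :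
    (signlessIndex G • (1 : Matrix V V ℝ) - signlessLaplacian G).PosSemidef := by
  have hH : (signlessIndex G • (1 : Matrix V V ℝ) - signlessLaplacian G).IsHermitian := by
    refine Matrix.IsHermitian.sub ?_ (isHermitian_signlessLaplacian G)
    simp [Matrix.IsHermitian]
  rw [Matrix.posSemidef_iff_isHermitian_and_spectrum_nonneg]
  refine ⟨hH, fun μ hμ => ?_⟩
  have h : signlessIndex G - μ ∈ spectrum ℝ (signlessLaplacian G) := by
    rw [← Algebra.algebraMap_eq_smul_one, ← spectrum.singleton_sub_eq] at hμ
    obtain ⟨_, rfl, l, hl, rfl⟩ := hμ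
    simpa using hl
  have := (isGreatest_signlessIndex G).2 (by convert h)
  simpa using this

open Matrix in
theorem energy_le [Nonempty V] (G : SimpleGraph V) (x : V → ℝ) :
    energy G x ≤ 2 * (signlessIndex G * ∑ v, x v ^ 2) := by
  classical
  have h := (posSemidef_signlessIndex_sub G).dotProduct_mulVec_nonneg x
  simp only [Matrix.sub_mulVec, Matrix.smul_mulVec, Matrix.one_mulVec, dotProduct_sub,
    dotProduct_smul, star_trivial, smul_eq_mul] at h
  rw [energy_eq_sum_rowSum]
  simp only [dotProduct, signlessLaplacian_mulVec] at h
  simp only [pow_two]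
  linarith

open Matrix in
theorem rowSum_eq_of_energy_eq [Nonempty V] (G : SimpleGraph V) (x : V → ℝ)
    (h : energy G x = 2 * (signlessIndex G * ∑ v, x v ^ 2)) (v : V) :
    rowSum G x v = signlessIndex G * x v := by
  classical
  have h0 := ((posSemidef_signlessIndex_sub G).dotProduct_mulVec_zero_iff x).1 (by
    simp only [Matrix.sub_mulVec, Matrix.smul_mulVec, Matrix.one_mulVec, dotProduct_sub,
      dotProduct_smul, star_trivial, smul_eq_mul]
    rw [energy_eq_sum_rowSum] at h
    simp only [dotProduct, signlessLaplacian_mulVec]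
    simp only [pow_two] at h
    linarith)
  have h1 := congrFun h0 v
  simp only [Matrix.sub_mulVec, Matrix.smul_mulVec, Matrix.one_mulVec, Pi.sub_apply, Pi.smul_apply,
    smul_eq_mul, Pi.zero_apply, signlessLaplacian_mulVec] at h1
  linarith

/-- `x` is a positive eigenvector of `Q(G)` for the eigenvalue `q₁(G)`. -/
def IsPerron (G : SimpleGraph V) (x : V → ℝ) : Prop :=
  (∀ v, 0 < x v) ∧ ∀ v, rowSum G x v = signlessIndex G * x v

theorem IsPerron.energy_eq {G : SimpleGraph V} {x : V → ℝ} (hx : IsPerron G x) :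
    energy G x = 2 * (signlessIndex G * ∑ v, x v ^ 2) := by
  rw [energy_eq_sum_rowSum, Finset.mul_sum (a := signlessIndex G)]
  congr 1
  refine Finset.sum_congr rfl fun v _ => ?_
  rw [hx.2]
  ring

theorem IsPerron.sum_sq_pos [Nonempty V] {G : SimpleGraph V} {x : V → ℝ} (hx : IsPerron G x) :
    0 < ∑ v, x v ^ 2 :=
  Finset.sum_pos (fun v _ => pow_pos (hx.1 v) 2) Finset.univ_nonempty

/-- The absolute values of an eigenvector for `q₁(G)` do not have smaller energy, so they form an
eigenvector again; a zero coordinate would spread to all vertices. -/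
theorem exists_isPerron [Nonempty V] (G : SimpleGraph V) (hG : G.Preconnected) :
    ∃ x, IsPerron G x := by
  classical
  have hmem := (isGreatest_signlessIndex G).1
  rw [← Matrix.spectrum_toLin', ← Module.End.hasEigenvalue_iff_mem_spectrum] at hmem
  obtain ⟨y, hy⟩ := hmem.exists_hasEigenvector
  have hy1 : ∀ v, rowSum G y v = signlessIndex G * y v := fun v => by
    have := congrFun hy.apply_eq_smul v
    rw [Matrix.toLin'_apply, signlessLaplacian_mulVec] at this
    simpa using this
  have hsq : ∑ v, |y v| ^ 2 = ∑ v, y v ^ 2 := by simp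
  have hE : energy G y = 2 * (signlessIndex G * ∑ v, y v ^ 2) := by
    rw [energy_eq_sum_rowSum, Finset.mul_sum (a := signlessIndex G)]
    congr 1
    refine Finset.sum_congr rfl fun v _ => ?_
    rw [hy1]
    ring
  have hEle : energy G y ≤ energy G (fun v => |y v|) := by
    unfold energy
    refine Finset.sum_le_sum fun u _ => Finset.sum_le_sum fun v _ => ?_
    split_ifs
    · rw [← sq_abs (y u + y v)]
      exact pow_le_pow_left₀ (abs_nonneg _) (abs_add_le _ _) 2
    · exact le_rfl
  have hrow := rowSum_eq_of_energy_eq G (fun v => |y v|)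
    (le_antisymm (energy_le G _) (by rw [hsq, ← hE]; exact hEle))
  have hzero : ∀ u w, G.Adj u w → y u = 0 → y w = 0 := fun u w huw hu => by
    have h := hrow u
    simp only [rowSum, hu, abs_zero, mul_zero, zero_add] at h
    rw [Finset.sum_eq_zero_iff_of_nonneg (fun i _ => by positivity)] at h
    simpa [huw] using h w (Finset.mem_univ w)
  refine ⟨fun v => |y v|, fun v => abs_pos.2 fun hv => hy.2 (funext fun w => ?_), hrow⟩
  obtain ⟨p⟩ := hG v w
  induction p with
  | nil => exact hv
  | cons h p ih => exact ih (hzero _ _ h hv)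

/-- Comparison principle: a graph whose energy at the eigenvector of `G` is at least that of `G` has
at least the index of `G`. -/
theorem IsPerron.signlessIndex_le [Nonempty V] {G H : SimpleGraph V} {x : V → ℝ}
    (hx : IsPerron G x) (h : energy G x ≤ energy H x) : signlessIndex G ≤ signlessIndex H := by
  have h1 := energy_le H x
  rw [hx.energy_eq] at h
  exact le_of_mul_le_mul_right (by linarith) hx.sum_sq_pos

/-- Comparison principle, equality case: the eigenvector is shared. -/
theorem IsPerron.of_energy_le [Nonempty V] {G H : SimpleGraph V} {x : V → ℝ}
    (hx : IsPerron G x) (h : energy G x ≤ energy H x) (heq : signlessIndex G = signlessIndex H) :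
    IsPerron H x ∧ energy G x = energy H x := by
  have h1 := energy_le H x
  have h2 := hx.energy_eq
  rw [heq] at h2
  exact ⟨⟨hx.1, rowSum_eq_of_energy_eq H x (by linarith)⟩, by linarith⟩

/-- If two graphs with the same index share an eigenvector, then no neighbourhood in one is a
proper subset of the neighbourhood of the same vertex in the other. -/
theorem IsPerron.adj_of_adj {G H : SimpleGraph V} {x : V → ℝ} (hG : IsPerron G x)
    (hH : IsPerron H x) (heq : signlessIndex G = signlessIndex H) {v : V}
    (hsub : ∀ w, G.Adj v w → H.Adj v w) {w : V} (hw : H.Adj v w) : G.Adj v w := by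
  classical
  by_contra hn
  have h : rowSum G x v < rowSum H x v := by
    unfold rowSum
    refine Finset.sum_lt_sum (fun u _ => ?_) ⟨w, Finset.mem_univ w, ?_⟩
    · have := hG.1 u
      have := hG.1 v
      by_cases h1 : G.Adj v u
      · simp [h1, hsub u h1]
      · split_ifs <;> positivity
    · have := hG.1 w
      have := hG.1 v
      simp only [hn, hw, if_true, if_false]
      positivity
  rw [hG.2, hH.2, heq] at h
  exact lt_irrefl _ h

/-- If, apart from `u` and `v` themselves, the neighbours of `u` are among those of `v`, and `v` has
a further one, then the eigenvector is strictly larger at `v`. -/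
theorem IsPerron.lt_of_neighbors {G : SimpleGraph V} {x : V → ℝ} (hx : IsPerron G x) {u v w : V}
    (hsub : ∀ z, z ≠ v → G.Adj u z → G.Adj v z) (hw : G.Adj v w) (hwu : w ≠ u)
    (hn : ¬ G.Adj u w) : x u < x v := by
  classical
  by_contra! hle
  have hq : (∑ z, if G.Adj u z then x u - x v else 0) ≤ signlessIndex G * (x u - x v) := by
    rcases hle.eq_or_lt with h | h
    · simp [h]
    rw [← Finset.sum_filter, Finset.sum_const, nsmul_eq_mul]
    refine mul_le_mul_of_nonneg_right ?_ (by linarith)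
    refine le_of_mul_le_mul_right ?_ (hx.1 u)
    rw [← hx.2 u, rowSum, ← Finset.sum_filter, ← nsmul_eq_mul, ← Finset.sum_const]
    exact Finset.sum_le_sum fun z _ => by linarith [hx.1 z]
  have hu := hx.2 u
  have hv := hx.2 v
  unfold rowSum at hu hv
  have key : ∑ z, ((if G.Adj u z then x u + x z else 0) - (if G.Adj u z then x u - x v else 0))
      < ∑ z, if G.Adj v z then x v + x z else 0 := by
    -- Exchanging the terms at `u` and `v` makes the comparison hold term by term.
    rw [← Equiv.sum_comp (Equiv.swap u v)]
    refine Finset.sum_lt_sum (fun z _ => ?_) ⟨w, Finset.mem_univ w, ?_⟩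
    · rcases eq_or_ne z u with rfl | hzu
      · rw [Equiv.swap_apply_left, G.adj_comm v z]
        split_ifs <;> linarith
      rcases eq_or_ne z v with rfl | hzv
      · simp
      rw [Equiv.swap_apply_of_ne_of_ne hzu hzv]
      by_cases h : G.Adj u z
      · simp only [h, hsub z hzv h, if_true]
        linarith
      · have := hx.1 v
        have := hx.1 z
        simp only [h, if_false]
        split_ifs <;> linarith
    · have := hx.1 v
      have := hx.1 w
      rw [Equiv.swap_apply_of_ne_of_ne hwu hw.ne']
      simp only [hn, hw, if_true, if_false]
      linarith
  rw [Finset.sum_sub_distrib] at key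
  nlinarith

end Spectral

theorem energy_iso {V W : Type*} [Fintype V] [Fintype W] {G : SimpleGraph V} {H : SimpleGraph W}
    (e : G ≃g H) (x : W → ℝ) : energy G (x ∘ e) = energy H x := by
  classical
  unfold energy
  rw [← e.toEquiv.sum_comp]
  refine Finset.sum_congr rfl fun u _ => ?_
  rw [← e.toEquiv.sum_comp]
  refine Finset.sum_congr rfl fun v _ => ?_
  simp [e.map_adj_iff]

theorem rowSum_iso {V W : Type*} [Fintype V] [Fintype W] {G : SimpleGraph V} {H : SimpleGraph W}
    (e : G ≃g H) (x : W → ℝ) (v : V) : rowSum G (x ∘ e) v = rowSum H x (e v) := by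
  classical
  unfold rowSum
  rw [← e.toEquiv.sum_comp]
  refine Finset.sum_congr rfl fun w _ => ?_
  simp [e.map_adj_iff]

/-! ### Structure of `k`-trees -/

theorem IsKTree.of_iso {k : ℕ} {V : Type u} {G : SimpleGraph V} (h : IsKTree k G) :
    ∀ {W : Type v} {H : SimpleGraph W}, (G ≃g H) → IsKTree k H := by
  induction h with
  | @complete V _ G hV hG =>
    intro W H e
    have : Finite W := Finite.of_equiv V e.toEquiv
    refine .complete H (by rw [← hV, Nat.card_congr e.toEquiv]) ?_
    ext a b
    subst hG
    rw [← e.symm.map_adj_iff]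
    simp
  | @adjoin V G v s hs hN h ih =>
    intro W H e
    refine .adjoin H (e v) (s.map e.toEquiv.toEmbedding) ?_ ?_ (ih (W := ({e v}ᶜ : Set W)) ?_)
    · rw [SimpleGraph.isNClique_iff] at hs ⊢
      refine ⟨?_, by simpa using hs.2⟩
      rintro a ha b hb hab
      obtain ⟨a, ha', rfl⟩ := Finset.mem_map.1 (Finset.mem_coe.1 ha)
      obtain ⟨b, hb', rfl⟩ := Finset.mem_map.1 (Finset.mem_coe.1 hb)
      exact e.map_adj_iff.2 (hs.1 ha' hb' fun h => hab (by rw [h]))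
    · ext w
      have : w ∈ H.neighborSet (e v) ↔ e.symm w ∈ G.neighborSet v := by
        rw [SimpleGraph.mem_neighborSet, SimpleGraph.mem_neighborSet, ← e.symm.map_adj_iff]
        simp
      rw [this, hN, Finset.mem_coe, Finset.mem_coe, Finset.mem_map_equiv]
      rfl
    · refine ⟨e.toEquiv.subtypeEquiv fun a => by simp, ?_⟩
      intro a b
      simp [e.map_adj_iff]

/-- The number of ordered adjacent pairs of vertices in `W`. -/
noncomputable def adjCount {V : Type*} (G : SimpleGraph V) (W : Finset V) : ℕ :=
  open Classical in ∑ u ∈ W, ∑ w ∈ W, if G.Adj u w then 1 else 0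

/-- The number of edges of a `k`-tree on `m` vertices (for `k ≤ m`): its `j`-th vertex, counted from
`0`, has `min j k` earlier neighbours. For `m ≤ k` it is the number of edges of a clique. -/
def ktreeSize (k m : ℕ) : ℕ := ∑ j ∈ Finset.range m, min j k

/-- Here `s` is the neighbourhood of the vertex removed. -/
theorem adjCount_eq_erase {V : Type*} [DecidableEq V] (G : SimpleGraph V) {v : V} {s W : Finset V}
    (hN : G.neighborSet v = (s : Set V)) (hv : v ∈ W) :
    adjCount G W = adjCount G (W.erase v) + 2 * (s ∩ W.erase v).card := by
  classical
  have hadj : ∀ w, G.Adj v w ↔ w ∈ s := fun w => by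
    rw [← SimpleGraph.mem_neighborSet, hN, Finset.mem_coe]
  have hrow : ∑ w ∈ W.erase v, (if G.Adj v w then 1 else 0) = (s ∩ W.erase v).card := by
    rw [Finset.card_eq_sum_ones, Finset.inter_comm, ← Finset.filter_mem_eq_inter,
      Finset.sum_filter]
    simp only [hadj]
  unfold adjCount
  rw [← Finset.add_sum_erase _ _ hv, ← Finset.add_sum_erase _ _ hv]
  have : ∀ u ∈ W.erase v, (∑ w ∈ W, if G.Adj u w then 1 else 0)
      = (if G.Adj v u then 1 else 0) + ∑ w ∈ W.erase v, if G.Adj u w then 1 else 0 := fun u _ => by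
    rw [← Finset.add_sum_erase _ _ hv, G.adj_comm u v]
  rw [Finset.sum_congr rfl this, Finset.sum_add_distrib, hrow]
  simp
  ring

theorem adjCount_subtype {V : Type*} (G : SimpleGraph V) (S : Set V) (W : Finset V)
    [DecidablePred (· ∈ S)] (hW : ∀ w ∈ W, w ∈ S) :
    adjCount (G.induce S) (W.subtype (· ∈ S)) = adjCount G W := by
  classical
  unfold adjCount
  rw [← Finset.sum_subtype_of_mem (fun u => ∑ w ∈ W, if G.Adj u w then 1 else 0) hW]
  refine Finset.sum_congr rfl fun u _ => ?_
  rw [← Finset.sum_subtype_of_mem (fun w => if G.Adj u w then 1 else 0) hW]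
  simp

/-- A `k`-tree is as sparse as the `k`-star: any set of vertices spans at most `ktreeSize` edges,
and the whole vertex set spans exactly that many. -/
theorem IsKTree.adjCount_le_and_eq {k : ℕ} {V : Type u} {G : SimpleGraph V} (h : IsKTree k G) :
    (∀ W, adjCount G W ≤ 2 * ktreeSize k W.card) ∧
      ∀ W, (∀ v, v ∈ W) → adjCount G W = 2 * ktreeSize k W.card := by
  classical
  induction h with
  | @complete V _ G hV hG =>
    have : ∀ W, adjCount G W = 2 * ktreeSize k W.card := fun W => by
      have hle : W.card ≤ k := by
        have := Fintype.ofFinite V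
        rw [← hV, Nat.card_eq_fintype_card]
        exact Finset.card_le_univ W
      have h1 : ktreeSize k W.card = ∑ j ∈ Finset.range W.card, j :=
        Finset.sum_congr rfl fun j hj => min_eq_left (by
          have := Finset.mem_range.1 hj
          omega)
      rw [h1, mul_comm 2, Finset.sum_range_id_mul_two, adjCount, hG, mul_comm,
        mul_comm, ← smul_eq_mul, ← Finset.sum_const]
      refine Finset.sum_congr rfl fun u hu => ?_
      simp only [SimpleGraph.top_adj]
      rw [← Finset.sum_filter, Finset.filter_ne, ← Finset.card_eq_sum_ones,
        Finset.card_erase_of_mem hu]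
    exact ⟨fun W => (this W).le, fun W _ => this W⟩
  | @adjoin V G v s hs hN h ih =>
    have hvs : v ∉ s := fun hv => by
      have : v ∈ G.neighborSet v := hN ▸ hv
      simp at this
    have hsub : ∀ W : Finset V, ∀ w ∈ W.erase v, w ∈ ({v}ᶜ : Set V) := fun W w hw => by
      simpa using Finset.ne_of_mem_erase hw
    have hcard : ∀ W : Finset V, ((W.erase v).subtype (· ∈ ({v}ᶜ : Set V))).card
        = (W.erase v).card := fun W => by
      rw [Finset.card_subtype, Finset.filter_true_of_mem (hsub W)]
    have hsucc : ∀ m, ktreeSize k (m + 1) = ktreeSize k m + min m k := fun m =>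
      Finset.sum_range_succ _ _
    constructor
    · intro W
      have h1 := ih.1 ((W.erase v).subtype (· ∈ ({v}ᶜ : Set V)))
      rw [adjCount_subtype _ _ _ (hsub W), hcard W] at h1
      by_cases hv : v ∈ W
      · rw [adjCount_eq_erase G hN hv, ← Finset.card_erase_add_one hv, hsucc]
        have h2 : (s ∩ W.erase v).card ≤ min (W.erase v).card k :=
          le_min (Finset.card_le_card Finset.inter_subset_right)
            (hs.2 ▸ Finset.card_le_card Finset.inter_subset_left)
        omega
      · rwa [Finset.erase_eq_of_notMem hv] at h1
    · intro W hW
      have h1 := ih.2 ((W.erase v).subtype (· ∈ ({v}ᶜ : Set V))) (fun a => by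
        rw [Finset.mem_subtype, Finset.mem_erase]
        exact ⟨a.2, hW _⟩)
      rw [adjCount_subtype _ _ _ (hsub W), hcard W] at h1
      have hsW : s ⊆ W.erase v := fun a ha =>
        Finset.mem_erase.2 ⟨fun h => hvs (h ▸ ha), hW a⟩
      have h2 : min (W.erase v).card k = k := min_eq_right (hs.2 ▸ Finset.card_le_card hsW)
      rw [adjCount_eq_erase G hN (hW v), ← Finset.card_erase_add_one (hW v), hsucc, h1, h2,
        Finset.inter_eq_left.2 hsW, hs.2]
      ring

/-- A `k`-tree with more than `k` vertices has minimum degree at least `k`. -/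
theorem IsKTree.exists_neighbors {k : ℕ} {V : Type u} {G : SimpleGraph V} (h : IsKTree k G) :
    ∀ [Finite V], k < Nat.card V → ∀ u, ∃ t : Finset V, t.card = k ∧ ∀ w ∈ t, G.Adj u w := by
  classical
  induction h with
  | complete G hV hG => 
    intro _ hc
    omega
  | @adjoin V G v s hs hN h ih =>
    intro _ _ u
    have hadj : ∀ w, G.Adj v w ↔ w ∈ s := fun w => by
      rw [← SimpleGraph.mem_neighborSet, hN, Finset.mem_coe]
    have hvs : v ∉ s := fun hv => G.loopless.irrefl v ((hadj v).2 hv)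
    rcases eq_or_ne u v with rfl | huv
    · exact ⟨s, hs.2, fun w hw => (hadj w).2 hw⟩
    by_cases hc : k < Nat.card ({v}ᶜ : Set V)
    · obtain ⟨t, ht, htu⟩ := ih hc ⟨u, huv⟩
      refine ⟨t.map (Function.Embedding.subtype _), by simpa using ht, fun w hw => ?_⟩
      obtain ⟨z, hz, rfl⟩ := Finset.mem_map.1 hw
      exact htu z hz
    · -- The smaller tree has just the `k` vertices of the clique `s`.
      have hsu : (s : Set V) = {v}ᶜ := by
        refine Set.eq_of_subset_of_ncard_le (fun w hw => fun h => hvs (h ▸ hw)) ?_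
        rw [Set.ncard_coe_finset, hs.2]
        exact not_lt.1 hc
      have hus : u ∈ s := by
        rw [← Finset.mem_coe, hsu]
        exact huv
      refine ⟨insert v (s.erase u), ?_, fun w hw => ?_⟩
      · rw [Finset.card_insert_of_notMem (fun h => hvs (Finset.mem_of_mem_erase h)),
          Finset.card_erase_add_one hus, hs.2]
      · rcases Finset.mem_insert.1 hw with rfl | hw
        · exact ((hadj u).2 hus).symm
        · exact hs.1 hus (Finset.mem_of_mem_erase hw) (Finset.ne_of_mem_erase hw).symm

/-- A `k`-tree has no induced cycle of length four. -/
theorem IsKTree.adj_or_adj {k : ℕ} {V : Type u} {G : SimpleGraph V} (h : IsKTree k G) :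
    ∀ {a b c d : V}, G.Adj a b → G.Adj b c → G.Adj c d → G.Adj d a → a ≠ c → b ≠ d →
      G.Adj a c ∨ G.Adj b d := by
  induction h with
  | complete G hV hG =>
    intro a b c d _ _ _ _ hac _
    left
    simpa [hG] using hac
  | @adjoin V G v s hs hN h ih =>
    have hadj : ∀ w, G.Adj v w → w ∈ s := fun w hw => by
      rw [← Finset.mem_coe, ← hN]
      exact hw
    intro a b c d hab hbc hcd hda hac hbd
    rcases eq_or_ne a v with rfl | ha
    · exact .inr (hs.1 (hadj _ hab) (hadj _ hda.symm) hbd)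
    rcases eq_or_ne b v with rfl | hb
    · exact .inl (hs.1 (hadj _ hab.symm) (hadj _ hbc) hac)
    rcases eq_or_ne c v with rfl | hc
    · exact .inr (hs.1 (hadj _ hbc.symm) (hadj _ hcd) hbd)
    rcases eq_or_ne d v with rfl | hd
    · exact .inl (hs.1 (hadj _ hda) (hadj _ hcd.symm) hac)
    exact ih (a := ⟨a, ha⟩) (b := ⟨b, hb⟩) (c := ⟨c, hc⟩) (d := ⟨d, hd⟩) hab hbc hcd hda
      (fun h => hac (congrArg Subtype.val h)) (fun h => hbd (congrArg Subtype.val h))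

theorem IsKTree.preconnected {k : ℕ} (hk : 1 ≤ k) {V : Type u} {G : SimpleGraph V}
    (h : IsKTree k G) : G.Preconnected := by
  induction h with
  | complete G hV hG => exact hG ▸ SimpleGraph.preconnected_top
  | @adjoin V G v s hs hN h ih =>
    have hadj : ∀ w, w ∈ s → G.Adj v w := fun w hw => by
      rw [← SimpleGraph.mem_neighborSet, hN]
      exact hw
    obtain ⟨w, hw⟩ : s.Nonempty := Finset.card_pos.1 (by rw [hs.2]; omega)
    have hv : ∀ u, G.Reachable v u := fun u => by
      rcases eq_or_ne u v with rfl | hu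
      · rfl
      exact (hadj w hw).reachable.trans
        ((ih ⟨w, (hadj w hw).ne'⟩ ⟨u, hu⟩).map (SimpleGraph.Embedding.induce _).toHom)
    exact fun a b => (hv a).symm.trans (hv b)

/-! ### Joins of a clique with a double star -/

/-- The graph in which the vertices of `A` are joined to all vertices, `b` to all vertices outside
`T` and `c` to all vertices of `T`. For disjoint `A`, `{b}`, `{c}`, `T` this is the join of a
complete graph on `A` with a double star: the centres `b` and `c` are adjacent, the leaves at `c`
are the vertices of `T`, and all the other vertices are leaves at `b`. -/
def broom {V : Type*} (A T : Finset V) (b c : V) : SimpleGraph V :=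
  SimpleGraph.fromRel fun u v => u ∈ A ∨ (u = b ∧ v ∉ T) ∨ (u = c ∧ v ∈ T)

/-- The side conditions under which `broom A T b c` is the join of a clique and a double star. -/
structure IsBroomData {V : Type*} (A T : Finset V) (b c : V) : Prop where
  bA : b ∉ A
  cA : c ∉ A
  bT : b ∉ T
  cT : c ∉ T
  bc : b ≠ c
  AT : ∀ v ∈ A, v ∉ T

theorem broom_adj {V : Type*} {A T : Finset V} {b c u v : V} :
    (broom A T b c).Adj u v ↔ u ≠ v ∧ ((u ∈ A ∨ (u = b ∧ v ∉ T) ∨ (u = c ∧ v ∈ T)) ∨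
      (v ∈ A ∨ (v = b ∧ u ∉ T) ∨ (v = c ∧ u ∈ T))) :=
  SimpleGraph.fromRel_adj _ _ _

section

variable {V : Type*} {A T : Finset V} {b c : V}

theorem IsBroomData.mono {T' : Finset V} (h : IsBroomData A T b c) (hT : T' ⊆ T) :
    IsBroomData A T' b c :=
  ⟨h.bA, h.cA, fun hb => h.bT (hT hb), fun hc => h.cT (hT hc), h.bc, fun v hv hv' =>
    h.AT v hv (hT hv')⟩

variable [Fintype V] [DecidableEq V]

/-- The leaves of `broom A T b c` at `b`. -/
def otherLeaves (A T : Finset V) (b c : V) : Finset V :=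
  Finset.univ.filter fun v => v ∉ A ∧ v ∉ T ∧ v ≠ b ∧ v ≠ c

theorem mem_otherLeaves {v : V} :
    v ∈ otherLeaves A T b c ↔ v ∉ A ∧ v ∉ T ∧ v ≠ b ∧ v ≠ c := by
  simp [otherLeaves]

theorem IsBroomData.swap (h : IsBroomData A T b c) :
    IsBroomData A (otherLeaves A T b c) c b :=
  ⟨h.cA, h.bA, by simp [mem_otherLeaves], by simp [mem_otherLeaves], h.bc.symm, fun v hv => by
    simp [mem_otherLeaves, hv]⟩

/-- Exchanging the two centres exchanges the two sets of leaves. -/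
theorem broom_swap (h : IsBroomData A T b c) :
    broom A (otherLeaves A T b c) c b = broom A T b c := by
  have := h.bA
  have := h.cA
  have := h.bT
  have := h.cT
  have := h.bc
  have := h.AT
  ext u v
  simp only [broom_adj, mem_otherLeaves]
  grind

theorem IsBroomData.card_otherLeaves (h : IsBroomData A T b c) :
    A.card + T.card + 2 + (otherLeaves A T b c).card = Fintype.card V := by
  have h1 : Finset.univ = A ∪ (T ∪ (insert b (insert c (otherLeaves A T b c)))) := by
    ext v
    simp only [Finset.mem_univ, Finset.mem_union, Finset.mem_insert, mem_otherLeaves]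
    tauto
  have := h.bA
  have := h.cA
  have := h.bT
  have := h.cT
  have := h.bc
  have := h.AT
  rw [← Finset.card_univ, h1, Finset.card_union_of_disjoint, Finset.card_union_of_disjoint,
    Finset.card_insert_of_notMem, Finset.card_insert_of_notMem]
  · ring
  · simp [mem_otherLeaves]
  · simp [mem_otherLeaves, h.bc]
  · rw [Finset.disjoint_left]
    intro v hv
    simp only [Finset.mem_insert, mem_otherLeaves]
    grind
  · rw [Finset.disjoint_left]
    intro v hv
    simp only [Finset.mem_union, Finset.mem_insert, mem_otherLeaves]
    grind

/-- Moving the leaves in `T` from `b` to `c` changes the energy leaf by leaf. -/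
theorem energy_broom (h : IsBroomData A T b c) (x : V → ℝ) :
    energy (broom A T b c) x = energy (broom A ∅ b c) x
      - 2 * ∑ j ∈ T, ((x b + x j) ^ 2 - (x c + x j) ^ 2) := by
  classical
  have hb := h.bA
  have hc := h.cA
  have hbT := h.bT
  have hcT := h.cT
  have hbc := h.bc
  have hAT := h.AT
  have key : ∀ u v, (if (broom A T b c).Adj u v then (x u + x v) ^ 2 else 0)
      = (if (broom A ∅ b c).Adj u v then (x u + x v) ^ 2 else 0)
        - (if u = b then (if v ∈ T then (x u + x v) ^ 2 else 0) else 0)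
        - (if v = b then (if u ∈ T then (x u + x v) ^ 2 else 0) else 0)
        + (if u = c then (if v ∈ T then (x u + x v) ^ 2 else 0) else 0)
        + (if v = c then (if u ∈ T then (x u + x v) ^ 2 else 0) else 0) := by
    intro u v
    simp only [broom_adj]
    by_cases hu : u ∈ T <;> by_cases hv : v ∈ T <;> by_cases hub : u = b <;>
      by_cases hvb : v = b <;> by_cases huc : u = c <;> by_cases hvc : v = c <;>
      by_cases huA : u ∈ A <;> by_cases hvA : v ∈ A <;> by_cases huv : u = v <;>
      first
        | (exfalso; grind)
        | (simp [*]; done)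
        | grind
  unfold energy
  simp_rw [key, Finset.sum_add_distrib, Finset.sum_sub_distrib]
  simp only [Finset.sum_ite_eq', Finset.sum_ite_mem, Finset.univ_inter, Finset.mem_univ, if_true,
    Finset.sum_ite_irrel, Finset.sum_const_zero]
  simp only [add_comm (x _) (x b), add_comm (x _) (x c)]
  ring

end

/-- A broom is determined up to isomorphism by the sizes of its parts. -/
theorem nonempty_broom_iso {V W : Type*} [Fintype V] [Fintype W] {A T : Finset V} {b c : V}
    {A' T' : Finset W} {b' c' : W} (h : IsBroomData A T b c) (h' : IsBroomData A' T' b' c')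
    (hV : Fintype.card V = Fintype.card W) (hA : A.card = A'.card) (hT : T.card = T'.card) :
    Nonempty (broom A T b c ≃g broom A' T' b' c') := by
  classical
  have hO : (otherLeaves A T b c).card = (otherLeaves A' T' b' c').card := by
    have := h.card_otherLeaves
    have := h'.card_otherLeaves
    omega
  let f : V → Fin 5 := fun v => if v ∈ A then 0 else if v = b then 1 else if v = c then 2 else
    if v ∈ T then 3 else 4
  let f' : W → Fin 5 := fun v => if v ∈ A' then 0 else if v = b' then 1 else if v = c' then 2 else
    if v ∈ T' then 3 else 4
  have hf : ∀ v, (f v = 0 ↔ v ∈ A) ∧ (f v = 1 ↔ v = b) ∧ (f v = 2 ↔ v = c) ∧ (f v = 3 ↔ v ∈ T) ∧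
      (f v = 4 ↔ v ∈ otherLeaves A T b c) := fun v => by
    have := h.bA
    have := h.cA
    have := h.bT
    have := h.cT
    have := h.bc
    have := h.AT
    simp only [f, mem_otherLeaves]
    grind
  have hf' : ∀ v, (f' v = 0 ↔ v ∈ A') ∧ (f' v = 1 ↔ v = b') ∧ (f' v = 2 ↔ v = c') ∧
      (f' v = 3 ↔ v ∈ T') ∧ (f' v = 4 ↔ v ∈ otherLeaves A' T' b' c') := fun v => by
    have := h'.bA
    have := h'.cA
    have := h'.bT
    have := h'.cT
    have := h'.bc
    have := h'.AT
    simp only [f', mem_otherLeaves]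
    grind
  have hfib : ∀ i, Nonempty ({v // f v = i} ≃ {v // f' v = i}) := fun i => by
    refine ⟨Fintype.equivOfCardEq ?_⟩
    rw [Fintype.card_subtype, Fintype.card_subtype]
    fin_cases i
    · simpa [(hf _).1, (hf' _).1] using hA
    · trans 1
      · exact Finset.card_eq_one.2 ⟨b, by ext v; simpa using (hf v).2.1⟩
      · exact (Finset.card_eq_one.2 ⟨b', by ext v; simpa using (hf' v).2.1⟩).symm
    · trans 1
      · exact Finset.card_eq_one.2 ⟨c, by ext v; simpa using (hf v).2.2.1⟩
      · exact (Finset.card_eq_one.2 ⟨c', by ext v; simpa using (hf' v).2.2.1⟩).symm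
    · simpa [(hf _).2.2.2.1, (hf' _).2.2.2.1] using hT
    · simpa [(hf _).2.2.2.2, (hf' _).2.2.2.2] using hO
  let e : V ≃ W := Equiv.ofFiberEquiv fun i => (hfib i).some
  have he : ∀ v, f' (e v) = f v := fun v => Equiv.ofFiberEquiv_map _ v
  refine ⟨⟨e, ?_⟩⟩
  intro u v
  simp only [broom_adj, ← (hf _).1, ← (hf _).2.1, ← (hf _).2.2.1, ← (hf _).2.2.2.1,
    ← (hf' _).1, ← (hf' _).2.1, ← (hf' _).2.2.1, ← (hf' _).2.2.2.1, he, ne_eq,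
    EmbeddingLike.apply_eq_iff_eq]

/-! ### The index of brooms, and the three extremal graphs -/

section Iso

variable {V : Type u} {W : Type v} [Fintype V] [Fintype W] {G : SimpleGraph V} {H : SimpleGraph W}

theorem signlessIndex_le_of_iso [Nonempty V] (e : G ≃g H) (hG : G.Preconnected) :
    signlessIndex G ≤ signlessIndex H := by
  have : Nonempty W := ⟨e (Classical.arbitrary V)⟩
  obtain ⟨x, hx⟩ := exists_isPerron G hG
  have h1 := energy_le H (x ∘ e.symm)
  have h2 : ∑ v, (x ∘ e.symm) v ^ 2 = ∑ w, x w ^ 2 := e.symm.toEquiv.sum_comp fun w => x w ^ 2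
  rw [energy_iso, hx.energy_eq, h2] at h1
  exact le_of_mul_le_mul_right (by linarith) hx.sum_sq_pos

theorem signlessIndex_eq_of_iso [Nonempty V] (e : G ≃g H) (hG : G.Preconnected) :
    signlessIndex G = signlessIndex H := by
  have : Nonempty W := ⟨e (Classical.arbitrary V)⟩
  exact le_antisymm (signlessIndex_le_of_iso e hG)
    (signlessIndex_le_of_iso e.symm (e.preconnected_iff.1 hG))

theorem IsPerron.comp_iso [Nonempty V] (e : G ≃g H) (hG : G.Preconnected) {x : W → ℝ}
    (hx : IsPerron H x) : IsPerron G (x ∘ e) := by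
  refine ⟨fun v => hx.1 _, fun v => ?_⟩
  rw [rowSum_iso, hx.2, signlessIndex_eq_of_iso e hG]
  rfl

end Iso

/-- A broom with `k - 1` hubs is a `k`-tree: removing its leaves one by one leaves a clique on
`k + 1` vertices. The number `N` of vertices is explicit for the induction. -/
theorem isKTree_broom {k : ℕ} : ∀ (N : ℕ) {V : Type u} [Fintype V], Fintype.card V = N →
    ∀ {A T : Finset V} {b c : V}, IsBroomData A T b c → A.card + 1 = k →
      IsKTree k (broom A T b c) := by
  classical
  intro N
  induction N with
  | zero =>
    intro V _ hV A T b
    exact ((Fintype.card_eq_zero_iff.1 hV).false b).elim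
  | succ N ih =>
    intro V _ hV A T b c h hA
    have hclique : ∀ {A T : Finset V} {b c : V}, IsBroomData A T b c → A.card + 1 = k →
        (broom A T b c).IsNClique k (insert b A) := fun {A T b c} h hA => by
      refine ⟨fun u hu w hw huw => ?_, by rw [Finset.card_insert_of_notMem h.bA, hA]⟩
      rw [Finset.mem_coe, Finset.mem_insert] at hu hw
      rw [broom_adj]
      grind
    -- Removing a leaf at `b`.
    have step : ∀ {A T : Finset V} {b c v : V}, IsBroomData A T b c → A.card + 1 = k →
        v ∈ otherLeaves A T b c → IsKTree k (broom A T b c) := fun {A T b c v} h hA hv => by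
      rw [mem_otherLeaves] at hv
      obtain ⟨hvA, hvT, hvb, hvc⟩ := hv
      refine .adjoin _ v (insert b A) (hclique h hA) ?_ ?_
      · ext w
        simp only [SimpleGraph.mem_neighborSet, broom_adj, Finset.coe_insert, Set.mem_insert_iff,
          Finset.mem_coe]
        grind
      · have hAv : ∀ w ∈ A, w ∈ ({v}ᶜ : Set V) := fun w hw hwv => hvA (hwv ▸ hw)
        have := ih (V := ({v}ᶜ : Set V))
          (by rw [Fintype.card_compl_set]; simp [hV])
          (A := A.subtype (· ∈ ({v}ᶜ : Set V))) (T := T.subtype (· ∈ ({v}ᶜ : Set V)))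
          (b := ⟨b, Ne.symm hvb⟩) (c := ⟨c, Ne.symm hvc⟩)
          ⟨by simpa using h.bA, by simpa using h.cA, by simpa using h.bT, by simpa using h.cT,
            fun hbc => h.bc (congrArg Subtype.val hbc), fun w => by simpa using h.AT w⟩
          (by rw [Finset.card_subtype, Finset.filter_true_of_mem hAv, hA])
        convert this
        ext u w
        simp [broom_adj, Subtype.ext_iff]
    by_cases hO : (otherLeaves A T b c).Nonempty
    · exact step h hA hO.choose_spec
    rw [Finset.not_nonempty_iff_eq_empty] at hO
    by_cases hT : T.Nonempty
    · obtain ⟨v, hv⟩ := hT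
      rw [← broom_swap h]
      refine step (v := v) h.swap hA ?_
      have := h.AT v
      have := h.bT
      have := h.cT
      rw [mem_otherLeaves, hO]
      grind
    · rw [Finset.not_nonempty_iff_eq_empty] at hT
      subst hT
      have hall : ∀ v, v ∈ A ∨ v = b ∨ v = c := fun v => by
        have : v ∉ otherLeaves A ∅ b c := by simp [hO]
        rw [mem_otherLeaves] at this
        simp at this
        tauto
      have hcard := h.card_otherLeaves
      rw [hO] at hcard
      simp only [Finset.card_empty] at hcard
      refine .adjoin _ c (insert b A) (hclique h hA) ?_ (.complete _ ?_ ?_)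
      · have := h.cA
        have := h.bc
        ext w
        simp only [SimpleGraph.mem_neighborSet, broom_adj, Finset.coe_insert, Set.mem_insert_iff,
          Finset.mem_coe]
        grind
      · rw [Nat.card_eq_fintype_card, Fintype.card_compl_set]
        simp
        omega
      · ext ⟨u, hu⟩ ⟨w, hw⟩
        have h1 := hall u
        have h2 := hall w
        simp only [Set.mem_compl_iff, Set.mem_singleton_iff] at hu hw
        simp only [SimpleGraph.comap_adj, broom_adj, SimpleGraph.top_adj,
          Function.Embedding.subtype_apply, ne_eq, Subtype.mk.injEq]
        grind

section BroomIndex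

variable {V : Type u} [Fintype V] {A T T' : Finset V} {b c : V}

theorem IsBroomData.preconnected (h : IsBroomData A T b c) : (broom A T b c).Preconnected :=
  (isKTree_broom _ rfl h rfl).preconnected (Nat.le_add_left 1 _)

/-- Moving leaves from `c` to `b` increases the index if `b` has the larger coordinate. -/
theorem IsBroomData.signlessIndex_lt_of_ssubset [Nonempty V] (h : IsBroomData A T b c) (hT : T' ⊂ T)
    {x : V → ℝ} (hx : IsPerron (broom A T b c) x) (hbc : x c ≤ x b) :
    signlessIndex (broom A T b c) < signlessIndex (broom A T' b c) := by
  classical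
  have hE : energy (broom A T b c) x ≤ energy (broom A T' b c) x := by
    rw [energy_broom h, energy_broom (h.mono hT.1)]
    have : ∑ j ∈ T', ((x b + x j) ^ 2 - (x c + x j) ^ 2)
        ≤ ∑ j ∈ T, ((x b + x j) ^ 2 - (x c + x j) ^ 2) := by
      refine Finset.sum_le_sum_of_subset_of_nonneg hT.1 fun j _ _ => ?_
      have := hx.1 j
      have := hx.1 c
      nlinarith
    linarith
  refine lt_of_le_of_ne (hx.signlessIndex_le hE) fun heq => ?_
  obtain ⟨w, hw, hw'⟩ := Finset.exists_of_ssubset hT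
  have hbw : b ≠ w := fun hb => h.bT (hb ▸ hw)
  -- The vertex `b` gains the neighbour `w`.
  have := hx.adj_of_adj (hx.of_energy_le hE heq).1 heq (v := b) (w := w) (fun z hz => by
    have := hT.1
    have := h.bT
    have := h.bc
    rw [broom_adj] at hz ⊢
    grind) (by rw [broom_adj]; tauto)
  rw [broom_adj] at this
  have := h.bT
  have := h.bA
  have := h.bc
  have := h.AT
  grind

/-- A more unbalanced broom has a larger index: leaves are moved to whichever centre carries the
larger coordinate. -/
theorem IsBroomData.signlessIndex_lt [DecidableEq V] {A' : Finset V} {b' c' : V}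
    (h : IsBroomData A T b c)
    (h' : IsBroomData A' T' b' c') (hA : A.card = A'.card) (hT : T'.card < T.card)
    (hO : T'.card < (otherLeaves A T b c).card) :
    signlessIndex (broom A T b c) < signlessIndex (broom A' T' b' c') := by
  have : Nonempty V := ⟨b⟩
  obtain ⟨x, hx⟩ := exists_isPerron _ h.preconnected
  have key : ∀ {T : Finset V} {b c : V}, IsBroomData A T b c → T'.card < T.card →
      IsPerron (broom A T b c) x → x c ≤ x b →
      signlessIndex (broom A T b c) < signlessIndex (broom A' T' b' c') := by
    intro T b c h hT hx hbc
    obtain ⟨S, hS, hcard⟩ := Finset.exists_subset_card_eq hT.le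
    have hlt := h.signlessIndex_lt_of_ssubset (Finset.ssubset_iff_subset_ne.2
      ⟨hS, fun hST => by rw [hST] at hcard; omega⟩) hx hbc
    obtain ⟨e⟩ := nonempty_broom_iso (h.mono hS) h' rfl hA hcard
    rwa [signlessIndex_eq_of_iso e (h.mono hS).preconnected] at hlt
  rcases le_total (x c) (x b) with hbc | hbc
  · exact key h hT hx hbc
  · rw [← broom_swap h] at hx ⊢
    exact key h.swap hO hx hbc

end BroomIndex

/-- The first `k - 1` vertices. -/
def hubs (k n : ℕ) : Finset (Fin n) := Finset.univ.filter fun i => i.val < k - 1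

theorem mem_hubs {k n : ℕ} {i : Fin n} : i ∈ hubs k n ↔ i.val < k - 1 := by simp [hubs]

theorem card_hubs {k n : ℕ} (h : k ≤ n) : (hubs k n).card = k - 1 := by
  rw [hubs, Fin.card_filter_val_lt]
  omega

theorem kStar_eq_broom {k n : ℕ} (hk : 1 ≤ k) (hn : k + 1 ≤ n) (c : Fin n) :
    kStar k n = broom (hubs k n) ∅ ⟨k - 1, by omega⟩ c := by
  ext i j
  simp only [kStar, SimpleGraph.fromRel_adj, broom_adj, mem_hubs, Fin.ext_iff, Finset.notMem_empty,
    not_false_eq_true, and_true, and_false, or_false, ne_eq]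
  omega

theorem graphG1_eq_broom {k n : ℕ} (hk : 1 ≤ k) (hn : k + 2 ≤ n) :
    graphG1 k n = broom (hubs k n) {⟨k, by omega⟩} ⟨k - 1, by omega⟩ ⟨k + 1, by omega⟩ := by
  ext i j
  simp only [graphG1, kStar, oneEdge, SimpleGraph.sup_adj, SimpleGraph.sdiff_adj,
    SimpleGraph.fromRel_adj, broom_adj, mem_hubs, Fin.ext_iff, Finset.mem_singleton, ne_eq]
  omega

theorem graphG2_eq_broom {k n : ℕ} (hk : 1 ≤ k) (hn : k + 3 ≤ n) :
    graphG2 k n = broom (hubs k n) {⟨k, by omega⟩, ⟨k + 2, by omega⟩} ⟨k - 1, by omega⟩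
      ⟨k + 1, by omega⟩ := by
  ext i j
  simp only [graphG2, graphG1, kStar, oneEdge, SimpleGraph.sup_adj, SimpleGraph.sdiff_adj,
    SimpleGraph.fromRel_adj, broom_adj, mem_hubs, Fin.ext_iff, Finset.mem_singleton,
    Finset.mem_insert, ne_eq]
  omega

theorem isBroomData_hubs {k n : ℕ} {T : Finset (Fin n)} {b c : Fin n} (hk : 1 ≤ k)
    (hb : b.val = k - 1) (hc : k ≤ c.val) (hT : ∀ i ∈ T, k ≤ i.val ∧ i ≠ c) :
    IsBroomData (hubs k n) T b c := by
  refine ⟨?_, ?_, fun h => ?_, fun h => (hT _ h).2 rfl, fun h => ?_, fun v hv hvT => ?_⟩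
  · rw [mem_hubs]; omega
  · rw [mem_hubs]; omega
  · have := (hT _ h).1
    omega
  · rw [h] at hb
    omega
  · have := (hT _ hvT).1
    rw [mem_hubs] at hv
    omega

/-! ### Majorization by the `k`-star -/

/-- A form of summation by parts: weighting with an antitone nonnegative sequence preserves the
nonpositivity of all partial sums. -/
theorem sum_mul_nonpos_of_antitone {n : ℕ} (c M : Fin n → ℝ) (hM : Antitone M) (h0 : ∀ j, 0 ≤ M j)
    (hc : ∀ m : ℕ, ∑ j : Fin n, (if j.val < m then c j else 0) ≤ 0) : ∑ j, c j * M j ≤ 0 := by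
  induction n with
  | zero => simp
  | succ n ih =>
    have h1 := ih (fun j => c j.castSucc) (fun j => M j.castSucc - M (Fin.last n))
      (fun i j hij => sub_le_sub_right (hM (Fin.castSucc_le_castSucc_iff.2 hij)) _)
      (fun j => sub_nonneg.2 (hM (Fin.le_last _))) (fun m => by
        have := hc (min m n)
        rw [Fin.sum_univ_castSucc] at this
        simpa using this)
    have h2 := hc (n + 1)
    have h3 : ∑ j : Fin (n + 1), (if j.val < n + 1 then c j else 0) = ∑ j, c j :=
      Finset.sum_congr rfl fun j _ => if_pos j.2
    rw [h3, Fin.sum_univ_castSucc] at h2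
    rw [Fin.sum_univ_castSucc]
    simp only [mul_sub, Finset.sum_sub_distrib, ← Finset.sum_mul] at h1
    nlinarith [mul_nonpos_of_nonpos_of_nonneg h2 (h0 (Fin.last n))]

theorem sum_sum_eq_two_mul {n : ℕ} (g : Fin n → Fin n → ℝ) (hg : ∀ i j, g i j = g j i)
    (h0 : ∀ i, g i i = 0) :
    ∑ i, ∑ j, g i j = 2 * ∑ j, ∑ i, if i < j then g i j else 0 := by
  have h : ∀ i j, g i j = (if i < j then g i j else 0) + if j < i then g j i else 0 := fun i j => by
    rcases lt_trichotomy i j with h | rfl | h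
    · simp [h, h.not_gt]
    · simp [h0]
    · simp [h, h.not_gt, hg i j]
  have h1 : ∑ i, ∑ j, g i j
      = ∑ i, ∑ j, ((if i < j then g i j else 0) + if j < i then g j i else 0) :=
    Finset.sum_congr rfl fun i _ => Finset.sum_congr rfl fun j _ => h i j
  rw [h1]
  simp_rw [Finset.sum_add_distrib]
  rw [Finset.sum_comm, two_mul]

theorem ext_of_lt {V : Type*} [LinearOrder V] {G H : SimpleGraph V}
    (h : ∀ u v, u < v → (G.Adj u v ↔ H.Adj u v)) : G = H := by
  ext u v
  rcases lt_trichotomy u v with huv | rfl | huv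
  · exact h u v huv
  · simp
  · rw [G.adj_comm, H.adj_comm]
    exact h v u huv

open Classical in
/-- The number of edges from `j` to smaller vertices, minus that number in the `k`-star. -/
noncomputable def backExcess {n : ℕ} (k : ℕ) (G : SimpleGraph (Fin n)) (j : Fin n) : ℝ :=
  ∑ i, if i < j then (if G.Adj i j then 1 else 0) - (if i.val < k then 1 else 0) else 0

/-- The prefix sums of `backExcess` compare the edges spanned by the first `m` vertices. -/
theorem sum_backExcess {k n : ℕ} (G : SimpleGraph (Fin n)) (m : ℕ) :
    2 * ∑ j : Fin n, (if j.val < m then backExcess k G j else 0)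
      = adjCount G (Finset.univ.filter fun j => j.val < m) - 2 * ktreeSize k (min m n) := by
  classical
  have h1 : ∑ j : Fin n, (if j.val < m then ∑ i : Fin n, (if i < j then (if i.val < k then (1 : ℝ)
      else 0) else 0) else 0) = ktreeSize k (min m n) := by
    have hj : ∀ j : Fin n, ∑ i : Fin n, (if i < j then (if i.val < k then (1 : ℝ) else 0) else 0)
        = (min j.val k : ℕ) := fun j => by
      have : ∀ i : Fin n, (if i < j then (if i.val < k then (1 : ℝ) else 0) else 0)
          = if i.val < min j.val k then 1 else 0 := fun i => by
        rw [← ite_and]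
        exact if_congr (by rw [lt_min_iff, Fin.lt_def]) rfl rfl
      simp_rw [this]
      rw [Finset.sum_boole, Fin.card_filter_val_lt]
      congr 1
      have := j.2
      omega
    simp_rw [hj]
    rw [Fin.sum_univ_eq_sum_range (fun j => if j < m then ((min j k : ℕ) : ℝ) else 0) n,
      ← Finset.sum_filter, ktreeSize, Nat.cast_sum]
    refine Finset.sum_congr ?_ fun _ _ => rfl
    ext j
    simp only [Finset.mem_filter, Finset.mem_range]
    omega
  have h2 : (adjCount G (Finset.univ.filter fun j => j.val < m) : ℝ)
      = 2 * ∑ j : Fin n, (if j.val < m then ∑ i : Fin n, (if i < j then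
        (if G.Adj i j then (1 : ℝ) else 0) else 0) else 0) := by
    unfold adjCount
    push_cast
    simp_rw [Finset.sum_filter]
    have := sum_sum_eq_two_mul (fun i j : Fin n => if i.val < m then (if j.val < m then
      (if G.Adj i j then (1 : ℝ) else 0) else 0) else 0) (fun i j => by
        simp only [G.adj_comm i j]
        split_ifs <;> rfl) (fun i => by simp)
    have h3 : ∀ i : Fin n, (if i.val < m then ∑ j : Fin n, (if j.val < m then
        (if G.Adj i j then (1 : ℝ) else 0) else 0) else 0) = ∑ j : Fin n, if i.val < m then
        (if j.val < m then (if G.Adj i j then (1 : ℝ) else 0) else 0) else 0 := fun i => by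
      split_ifs <;> simp
    simp_rw [h3]
    rw [this]
    congr 1
    refine Finset.sum_congr rfl fun j _ => ?_
    by_cases hj : j.val < m
    · simp only [hj, if_true]
      refine Finset.sum_congr rfl fun i _ => ?_
      by_cases hij : i < j
      · have : i.val < m := lt_trans hij hj
        simp [hij, this]
      · simp [hij]
    · simp [hj]
  rw [← h1, h2, ← mul_sub, ← Finset.sum_sub_distrib]
  congr 1
  refine Finset.sum_congr rfl fun j _ => ?_
  unfold backExcess
  split_ifs
  · rw [← Finset.sum_sub_distrib]
    refine Finset.sum_congr rfl fun i _ => ?_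
    split_ifs <;> simp
  · simp

theorem card_filter_val_lt {n : ℕ} (m : ℕ) :
    (Finset.univ.filter fun j : Fin n => j.val < m).card = min m n := by
  rw [Fin.card_filter_val_lt, min_comm]

theorem IsKTree.sum_backExcess_nonpos {k n : ℕ} {G : SimpleGraph (Fin n)} (hG : IsKTree k G)
    (m : ℕ) : ∑ j : Fin n, (if j.val < m then backExcess k G j else 0) ≤ 0 := by
  have h := hG.adjCount_le_and_eq.1 (Finset.univ.filter fun j : Fin n => j.val < m)
  have h' := sum_backExcess (k := k) G m
  rw [card_filter_val_lt] at h
  have : (adjCount G (Finset.univ.filter fun j : Fin n => j.val < m) : ℝ)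
      ≤ 2 * ktreeSize k (min m n) := by exact_mod_cast h
  linarith

theorem IsKTree.sum_backExcess_eq_zero {k n : ℕ} {G : SimpleGraph (Fin n)} (hG : IsKTree k G) :
    ∑ j, backExcess k G j = 0 := by
  have h := hG.adjCount_le_and_eq.2 (Finset.univ.filter fun j : Fin n => j.val < n) (by simp)
  have h' := sum_backExcess (k := k) G n
  rw [card_filter_val_lt] at h
  rw [Finset.sum_congr rfl fun j _ => if_pos j.2] at h'
  have : (adjCount G (Finset.univ.filter fun j : Fin n => j.val < n) : ℝ)
      = 2 * ktreeSize k (min n n) := by exact_mod_cast h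
  linarith

open Classical in
/-- The pairs `i < j` adjacent in `G` but not in the `k`-star. -/
noncomputable def extraPairs {n : ℕ} (k : ℕ) (G : SimpleGraph (Fin n)) : Finset (Fin n × Fin n) :=
  Finset.univ.filter fun p => p.1 < p.2 ∧ k ≤ p.1.val ∧ G.Adj p.1 p.2

open Classical in
/-- The pairs `i < j` adjacent in the `k`-star but not in `G`. -/
noncomputable def missingPairs {n : ℕ} (k : ℕ) (G : SimpleGraph (Fin n)) :
    Finset (Fin n × Fin n) :=
  Finset.univ.filter fun p => p.1 < p.2 ∧ p.1.val < k ∧ ¬ G.Adj p.1 p.2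

theorem mem_extraPairs {k n : ℕ} {G : SimpleGraph (Fin n)} {i j : Fin n} :
    (i, j) ∈ extraPairs k G ↔ i < j ∧ k ≤ i.val ∧ G.Adj i j := by
  simp [extraPairs]

theorem mem_missingPairs {k n : ℕ} {G : SimpleGraph (Fin n)} {i j : Fin n} :
    (i, j) ∈ missingPairs k G ↔ i < j ∧ i.val < k ∧ ¬ G.Adj i j := by
  simp [missingPairs]

theorem IsKTree.card_missingPairs {k n : ℕ} {G : SimpleGraph (Fin n)} (hG : IsKTree k G) :
    (missingPairs k G).card = (extraPairs k G).card := by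
  classical
  have h : ∑ j, backExcess k G j
      = ((extraPairs k G).card : ℝ) - (missingPairs k G).card := by
    unfold extraPairs missingPairs backExcess
    rw [← Finset.sum_boole, ← Finset.sum_boole, ← Finset.sum_sub_distrib, Fintype.sum_prod_type,
      Finset.sum_comm]
    refine Finset.sum_congr rfl fun i _ => Finset.sum_congr rfl fun j _ => ?_
    by_cases h1 : i < j <;> by_cases h2 : i.val < k <;> by_cases h3 : G.Adj i j <;>
      simp [h1, h2, h3, not_le.2, not_lt.1]
  rw [hG.sum_backExcess_eq_zero] at h
  have : ((missingPairs k G).card : ℝ) = (extraPairs k G).card := by linarith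
  exact_mod_cast this

section Energy

variable {k n : ℕ} {G : SimpleGraph (Fin n)} {x : Fin n → ℝ} {p c : Fin n}

open Classical in
/-- The loss, for a pair `i < j`, when the smaller vertex of a missing pair is replaced with `p` and
the smaller vertex of an extra pair with `c`. -/
noncomputable def slack (k : ℕ) (G : SimpleGraph (Fin n)) (x : Fin n → ℝ) (p c i j : Fin n) : ℝ :=
  if i.val < k then (if G.Adj i j then 0 else (x i + x j) ^ 2 - (x p + x j) ^ 2)
  else (if G.Adj i j then (x c + x j) ^ 2 - (x i + x j) ^ 2 else 0)

theorem slack_nonneg (hp : p.val = k - 1) (hc : c.val = k) (hx : Antitone x)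
    (h0 : ∀ i, 0 ≤ x i) (i j : Fin n) : 0 ≤ slack k G x p c i j := by
  unfold slack
  have := h0 i
  have := h0 j
  have := h0 p
  have := h0 c
  split_ifs with h1 h2 h2
  · exact le_rfl
  · have : x p ≤ x i := hx (Fin.le_def.2 (by omega))
    nlinarith
  · have : x i ≤ x c := hx (Fin.le_def.2 (by omega))
    nlinarith
  · exact le_rfl

open Classical in
/-- The energy of a `k`-tree against the energy of the `k`-star, for an antitone vector. The missing
pairs and the extra pairs are matched through the partial sums of `backExcess`. -/
theorem IsKTree.energy_le_kStar (hG : IsKTree k G) (hx : Antitone x) (h0 : ∀ i, 0 ≤ x i) :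
    energy G x
      + 2 * ∑ q ∈ extraPairs k G, ((x p + x q.2) ^ 2 - (x c + x q.2) ^ 2)
      + 2 * ∑ j, ∑ i, (if i < j then slack k G x p c i j else 0) ≤ energy (kStar k n) x := by
  have hE : ∀ H : SimpleGraph (Fin n), energy H x = 2 * ∑ j, ∑ i, if i < j then
      (if H.Adj i j then (x i + x j) ^ 2 else 0) else 0 := fun H =>
    sum_sum_eq_two_mul (fun i j => if H.Adj i j then (x i + x j) ^ 2 else 0)
      (fun i j => by simp only [H.adj_comm i j, add_comm (x i)]) (fun i => by simp)
  have habel := sum_mul_nonpos_of_antitone (backExcess k G) (fun j => (x p + x j) ^ 2)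
    (fun i j hij => by
      have := hx hij
      have := h0 j
      have := h0 p
      exact pow_le_pow_left₀ (by positivity) (by linarith) 2)
    (fun j => sq_nonneg _) hG.sum_backExcess_nonpos
  have hex : ∑ q ∈ extraPairs k G, ((x p + x q.2) ^ 2 - (x c + x q.2) ^ 2)
      = ∑ j, ∑ i, if i < j then (if k ≤ i.val ∧ G.Adj i j then
        (x p + x j) ^ 2 - (x c + x j) ^ 2 else 0) else 0 := by
    unfold extraPairs
    rw [Finset.sum_filter, Fintype.sum_prod_type, Finset.sum_comm]
    refine Finset.sum_congr rfl fun j _ => Finset.sum_congr rfl fun i _ => ?_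
    rw [← ite_and]
  have hsum : ∑ j, backExcess k G j * (x p + x j) ^ 2
      = ∑ j, ∑ i, (if i < j then (if G.Adj i j then (x i + x j) ^ 2 else 0) else 0)
        + ∑ j, ∑ i, (if i < j then (if k ≤ i.val ∧ G.Adj i j then
          (x p + x j) ^ 2 - (x c + x j) ^ 2 else 0) else 0)
        + ∑ j, ∑ i, (if i < j then slack k G x p c i j else 0)
        - ∑ j, ∑ i, (if i < j then
          (if (kStar k n).Adj i j then (x i + x j) ^ 2 else 0) else 0) := by
    rw [← Finset.sum_add_distrib, ← Finset.sum_add_distrib, ← Finset.sum_sub_distrib]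
    refine Finset.sum_congr rfl fun j _ => ?_
    rw [← Finset.sum_add_distrib, ← Finset.sum_add_distrib, ← Finset.sum_sub_distrib, backExcess,
      Finset.sum_mul]
    refine Finset.sum_congr rfl fun i _ => ?_
    by_cases hij : i < j
    · have hS : (kStar k n).Adj i j ↔ i.val < k := by
        simp only [kStar, SimpleGraph.fromRel_adj, ne_eq, hij.ne, not_false_eq_true, true_and]
        exact ⟨fun h => h.elim id fun h => lt_trans hij h, Or.inl⟩
      have hle : (k ≤ i.val) = ¬ i.val < k := by simp
      simp only [hij, if_true, hS, slack]
      by_cases h2 : i.val < k <;> by_cases h3 : G.Adj i j <;>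
        simp only [hle, h2, h3, if_true, if_false, and_true, and_false, not_true_eq_false,
          not_false_eq_true] <;> ring
    · simp [hij]
  rw [hE G, hE (kStar k n), hex]
  linarith

end Energy

/-! ### Few extra edges -/

section Extremal

variable {k n : ℕ} {G : SimpleGraph (Fin n)} {x : Fin n → ℝ}

/-- As there are equally many missing and extra edges, no extra edge means no missing edge. -/
theorem eq_kStar_of_extraPairs_eq_empty (hG : IsKTree k G) (h : extraPairs k G = ∅) :
    G = kStar k n := by
  have hM : missingPairs k G = ∅ := by
    rw [← Finset.card_eq_zero, hG.card_missingPairs, h, Finset.card_empty]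
  refine ext_of_lt fun u v huv => ?_
  have hS : (kStar k n).Adj u v ↔ u.val < k := by
    simp only [kStar, SimpleGraph.fromRel_adj, ne_eq, huv.ne, not_false_eq_true, true_and]
    exact ⟨fun h => h.elim id fun h => lt_trans huv h, Or.inl⟩
  have h1 : (u, v) ∉ extraPairs k G := by simp [h]
  have h2 : (u, v) ∉ missingPairs k G := by simp [hM]
  rw [mem_extraPairs] at h1
  rw [mem_missingPairs] at h2
  rw [hS]
  have : k ≤ u.val ↔ ¬ u.val < k := not_lt.symm
  tauto

theorem adj_of_notMem_missingPairs {i j : Fin n} (hi : i.val < k) (hij : i < j)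
    (h : (i, j) ∉ missingPairs k G) : G.Adj i j := by
  rw [mem_missingPairs] at h
  tauto

theorem IsKTree.exists_adj_notMem_of_card_lt (hG : IsKTree k G) (hkn : k < n) {i : Fin n}
    {A : Finset (Fin n)} (hA : A.card < k) : ∃ w, w ∉ A ∧ G.Adj i w := by
  obtain ⟨t, ht, hadj⟩ := hG.exists_neighbors (by simpa using hkn) i
  obtain ⟨w, hw, hwA⟩ := Finset.exists_mem_notMem_of_card_lt_card (hA.trans_eq ht.symm)
  exact ⟨w, hwA, hadj w hw⟩

/-- If a single edge `c j` replaces a single edge `i i'` of the `k`-star, the result is the `k`-tree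
with the second largest index. -/
theorem iso_graphG1_of_extraPairs_eq_singleton (hk : 1 ≤ k) (hG : IsKTree k G) (hx : IsPerron G x)
    (hanti : Antitone x) {c j : Fin n} (h : extraPairs k G = {(c, j)}) :
    Nonempty (G ≃g graphG1 k n) := by
  classical
  have hcj : (c, j) ∈ extraPairs k G := by simp [h]
  rw [mem_extraPairs] at hcj
  obtain ⟨hcj, hck, hadj⟩ := hcj
  have hjn := j.2
  have hcj' : c.val < j.val := hcj
  have hcard : (missingPairs k G).card = 1 := by
    rw [hG.card_missingPairs, h, Finset.card_singleton]
  obtain ⟨⟨i, i'⟩, hM⟩ := Finset.card_eq_one.1 hcard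
  have hi : (i, i') ∈ missingPairs k G := by simp [hM]
  rw [mem_missingPairs] at hi
  obtain ⟨hii, hik, hnadj⟩ := hi
  have hcore : ∀ u v : Fin n, u.val < k → u < v → (u, v) ≠ (i, i') → G.Adj u v :=
    fun u v hu huv hne => adj_of_notMem_missingPairs hu huv (by simpa [hM] using hne)
  have hextra : ∀ u v : Fin n, k ≤ u.val → u < v → G.Adj u v → u = c ∧ v = j :=
    fun u v hu huv huv' => by
      have : (u, v) ∈ extraPairs k G := mem_extraPairs.2 ⟨huv, hu, huv'⟩
      simpa [h] using this
  have hextra' : ∀ u v : Fin n, k ≤ u.val → k ≤ v.val → G.Adj u v →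
      (u = c ∧ v = j) ∨ (u = j ∧ v = c) := fun u v hu hv huv => by
    rcases lt_trichotomy u v with h1 | h1 | h1
    · exact .inl (hextra u v hu h1 huv)
    · exact (huv.ne h1).elim
    · exact .inr (hextra v u hv h1 huv.symm).symm
  -- The two ends of the missing edge are not both in the core of the star.
  have hi'k : k ≤ i'.val := by
    by_contra! hi'k
    have hii' : i.val < i'.val := hii
    have hcore2 : ∀ u v : Fin n, u.val < k → k ≤ v.val → G.Adj u v := fun u v hu hv =>
      hcore u v hu (Fin.lt_def.2 (by omega)) (by rintro ⟨rfl, rfl⟩; omega)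
    by_cases hu : ∃ u : Fin n, k ≤ u.val ∧ u ≠ c ∧ u ≠ j
    · obtain ⟨u, huk, huc, huj⟩ := hu
      rcases hG.adj_or_adj (hcore2 i c hik hck) (hcore2 i' c hi'k hck).symm (hcore2 i' u hi'k huk)
        (hcore2 i u hik huk).symm hii.ne huc.symm with h1 | h1
      · exact hnadj h1
      · rcases hextra' c u hck huk h1 with h2 | h2
        · exact huj h2.2
        · exact huc h2.2
    · push Not at hu
      -- With `k + 2` vertices `c` is adjacent to all others, so `x i < x c` although `i < c`.
      have := hx.lt_of_neighbors (u := i) (v := c) (w := i') (fun z hz hiz => by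
        by_cases hzk : z.val < k
        · exact (hcore2 z c hzk hck).symm
        · rwa [hu z (not_lt.1 hzk) hz]) (hcore2 i' c hi'k hck).symm hii.ne' hnadj
      exact this.not_ge (hanti (Fin.le_def.2 (by omega)))
  -- As `i'` still has `k` neighbours, it is an end of the extra edge; `w` is the other end.
  obtain ⟨w, hwi, hww⟩ : ∃ w : Fin n, w ≠ i' ∧ ((i' = c ∧ w = j) ∨ (i' = j ∧ w = c)) := by
    obtain ⟨z, hz, hadjz⟩ := hG.exists_adj_notMem_of_card_lt (by omega) (i := i')
      (A := (Finset.univ.filter fun a : Fin n => a.val < k).erase i) (by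
        rw [Finset.card_erase_of_mem (by simpa using hik), card_filter_val_lt]
        omega)
    have hzi : z ≠ i := fun h => hnadj (h ▸ hadjz).symm
    have hzk : k ≤ z.val := by simpa [hzi] using hz
    exact ⟨z, hadjz.ne', hextra' _ _ hi'k hzk hadjz⟩
  have hwk : k ≤ w.val := by
    rcases hww with h1 | h1 <;> rw [h1.2] <;> omega
  set A := (Finset.univ.filter fun a : Fin n => a.val < k).erase i with hA
  have hmemA : ∀ a, a ∈ A ↔ a ≠ i ∧ a.val < k := fun a => by simp [hA]
  have hdata : IsBroomData A {i'} i w := by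
    refine ⟨?_, ?_, ?_, ?_, ?_, ?_⟩
    · simp [hmemA]
    · rw [hmemA]
      omega
    · simpa using hii.ne
    · simpa using hwi
    · rintro rfl
      omega
    · intro v hv
      rw [hmemA] at hv
      rw [Finset.mem_singleton]
      rintro rfl
      omega
  have hGeq : G = broom A {i'} i w := by
    refine ext_of_lt fun u v huv => ?_
    have huv' : u.val < v.val := huv
    rw [broom_adj]
    simp only [hmemA, Finset.mem_singleton]
    by_cases hu : u.val < k
    · by_cases hne : (u, v) = (i, i')
      · obtain ⟨rfl, rfl⟩ := Prod.mk.inj hne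
        simp only [hnadj, false_iff]
        grind
      · simp only [hcore u v hu huv hne, true_iff]
        grind
    · have h1 : G.Adj u v ↔ u = c ∧ v = j :=
        ⟨hextra u v (not_lt.1 hu) huv, fun h => by rw [h.1, h.2]; exact hadj⟩
      rw [h1]
      grind
  rw [graphG1_eq_broom hk (by omega), hGeq]
  refine nonempty_broom_iso hdata (isBroomData_hubs hk rfl (Nat.le_succ k) ?_) rfl ?_ rfl
  · intro z hz
    rw [Finset.mem_singleton] at hz
    subst hz
    simp
  · rw [card_hubs (by omega), hA, Finset.card_erase_of_mem (by simpa using hik),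
      card_filter_val_lt]
    omega

/-- If all extra edges share their larger end `j`, then there is only one: otherwise some smaller
end has its neighbourhood inside that of `j`, so that its coordinate would be smaller. -/
theorem extraPairs_eq_singleton (hG : IsKTree k G) (hx : IsPerron G x)
    (hanti : Antitone x) {c j : Fin n} (hcj : (c, j) ∈ extraPairs k G)
    (h : ∀ q ∈ extraPairs k G, q.2 = j) : extraPairs k G = {(c, j)} := by
  classical
  by_contra hne
  set L := Finset.univ.filter fun i : Fin n => (i, j) ∈ extraPairs k G with hL
  have hmemL : ∀ i, i ∈ L ↔ i < j ∧ k ≤ i.val ∧ G.Adj i j := fun i => by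
    rw [hL, Finset.mem_filter, mem_extraPairs]
    simp
  have hExL : (extraPairs k G).card ≤ L.card := by
    refine (Finset.card_le_card ?_).trans (Finset.card_image_le (f := fun i => (i, j)) (s := L))
    rintro ⟨a, b⟩ hab
    obtain rfl : b = j := h _ hab
    simpa [hL] using hab
  have hindep : ∀ u ∈ L, ∀ v : Fin n, k ≤ v.val → G.Adj u v → v = j := fun u hu v hv huv => by
    rw [hmemL] at hu
    rcases lt_trichotomy u v with h1 | h1 | h1
    · exact h _ (mem_extraPairs.2 ⟨h1, hu.2.1, huv⟩)
    · exact (huv.ne h1).elim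
    · exact (hu.1.ne (h _ (mem_extraPairs.2 ⟨h1, hv, huv.symm⟩))).elim
  have hc : c ∈ L := by simpa [hL] using hcj
  obtain ⟨d, hd, hdc⟩ : ∃ d ∈ L, d ≠ c := by
    by_contra! hall
    refine hne (Finset.eq_singleton_iff_unique_mem.2 ⟨hcj, fun q hq => ?_⟩)
    have h1 := h q hq
    have h2 := hall q.1 (by rw [hL, Finset.mem_filter, ← h1]; exact ⟨Finset.mem_univ _, hq⟩)
    exact Prod.ext h2 h1
  have hnot : ∀ u ∈ L, ∀ v ∈ L, ¬ G.Adj u v := fun u hu v hv huv => by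
    have := hindep u hu v ((hmemL v).1 hv).2.1 huv
    exact ((hmemL v).1 hv).1.ne this
  -- Otherwise the neighbours of `u` are among those of `j`, and `x u < x j` although `u < j`.
  have hwit : ∀ u ∈ L, ∃ a : Fin n, a.val < k ∧ G.Adj a u ∧ ¬ G.Adj a j := fun u hu => by
    by_contra! hall
    obtain ⟨v, hv, hvu⟩ : ∃ v ∈ L, v ≠ u := by
      by_cases hcu : c = u
      · exact ⟨d, hd, hcu ▸ hdc⟩
      · exact ⟨c, hc, hcu⟩
    have := hx.lt_of_neighbors (u := u) (v := j) (w := v) (fun z hz huz => by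
      by_cases hzk : z.val < k
      · exact (hall z hzk huz.symm).symm
      · exact (hz (hindep u hu z (not_lt.1 hzk) huz)).elim) ((hmemL v).1 hv).2.2.symm hvu
      (hnot u hu v hv)
    exact this.not_ge (hanti ((hmemL u).1 hu).1.le)
  -- By the absence of induced four-cycles a core vertex not adjacent to `j` sees one vertex of `L`.
  have huniq : ∀ a : Fin n, ¬ G.Adj a j → a.val < k → ∀ u ∈ L, ∀ v ∈ L, u ≠ v → G.Adj a u →
      ¬ G.Adj a v := fun a haj hak u hu v hv huv hau hav => by
    have hju := ((hmemL u).1 hu)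
    rcases hG.adj_or_adj hau hju.2.2 ((hmemL v).1 hv).2.2.symm hav.symm (by
      rintro rfl
      have : u.val < a.val := hju.1
      omega) huv with h1 | h1
    · exact haj h1
    · exact hnot u hu v hv h1
  obtain ⟨a, hak, hac, haj⟩ := hwit c hc
  obtain ⟨b, hbk, hbd, hbj⟩ := hwit d hd
  have hab : a ≠ b := by
    rintro rfl
    exact huniq a haj hak c hc d hd hdc.symm hac hbd
  -- One missing pair more than there are extra pairs.
  have hmiss : insert (b, j) ((insert j (L.erase c)).image (Prod.mk a)) ⊆ missingPairs k G := by
    have hlt : ∀ a u : Fin n, a.val < k → k ≤ u.val → a < u := fun a u ha hu =>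
      Fin.lt_def.2 (by omega)
    have hjk : k ≤ j.val := by
      have h1 := (hmemL c).1 hc
      have h2 : c.val < j.val := h1.1
      omega
    intro q hq
    rw [Finset.mem_insert, Finset.mem_image] at hq
    rcases hq with rfl | ⟨u, hu, rfl⟩
    · exact mem_missingPairs.2 ⟨hlt b j hbk hjk, hbk, hbj⟩
    rcases Finset.mem_insert.1 hu with rfl | hu
    · exact mem_missingPairs.2 ⟨hlt a u hak hjk, hak, haj⟩
    · obtain ⟨huc, hu⟩ := Finset.mem_erase.1 hu
      exact mem_missingPairs.2 ⟨hlt a u hak ((hmemL u).1 hu).2.1, hak,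
        huniq a haj hak c hc u hu huc.symm hac⟩
  have hcard := Finset.card_le_card hmiss
  rw [Finset.card_insert_of_notMem, Finset.card_image_of_injective _ (Prod.mk_right_injective a),
    Finset.card_insert_of_notMem, Finset.card_erase_add_one hc, hG.card_missingPairs] at hcard
  · omega
  · intro hj
    exact ((hmemL j).1 (Finset.mem_of_mem_erase hj)).1.ne rfl
  · intro hq
    obtain ⟨u, _, hu⟩ := Finset.mem_image.1 hq
    exact hab (congrArg Prod.fst hu)

end Extremal

/-! ### Extra edges with two distinct larger ends -/

section BroomCoordinates

variable {V : Type*} [Fintype V] {A T : Finset V} {b c : V} {x : V → ℝ}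

/-- At a hub the eigenvector is larger than at the centre `b`. -/
theorem IsBroomData.lt_of_mem (h : IsBroomData A T b c) (hx : IsPerron (broom A T b c) x)
    (hT : T.Nonempty) {i : V} (hi : i ∈ A) : x b < x i := by
  obtain ⟨l, hl⟩ := hT
  have := h.bA
  have := h.bT
  have := h.bc
  have := h.AT
  refine hx.lt_of_neighbors (w := l) (fun z hz _ => ?_) ?_ ?_ ?_
  · exact broom_adj.2 ⟨hz.symm, .inl (.inl hi)⟩
  · exact broom_adj.2 ⟨by grind, .inl (.inl hi)⟩
  · grind
  · rw [broom_adj]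
    grind

/-- At any leaf, whether attached to `b` or to `c`, the eigenvector is smaller than at `c`. -/
theorem IsBroomData.leaf_lt (h : IsBroomData A T b c) (hx : IsPerron (broom A T b c) x)
    (hT : T.Nonempty) {j : V} (hjA : j ∉ A) (hjb : j ≠ b) (hjc : j ≠ c) : x j < x c := by
  obtain ⟨l, hl⟩ := hT
  have := h.bA
  have := h.cA
  have := h.bT
  have := h.cT
  have := h.bc
  have := h.AT
  by_cases hjT : j ∈ T
  · refine hx.lt_of_neighbors (w := b) (fun z hz hjz => ?_) ?_ hjb.symm ?_
    · rw [broom_adj] at hjz ⊢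
      grind
    · rw [broom_adj]
      grind
    · rw [broom_adj]
      grind
  · refine hx.lt_of_neighbors (w := l) (fun z hz hjz => ?_) ?_ (fun h => hjT (h ▸ hl)) ?_
    · rw [broom_adj] at hjz ⊢
      grind
    · rw [broom_adj]
      grind
    · rw [broom_adj]
      grind

end BroomCoordinates

section TwoEnds

variable {k n : ℕ} {G : SimpleGraph (Fin n)} {x : Fin n → ℝ}

/-- For an antitone function on `Fin n` two distinct terms weigh at least as much as the last
two. -/
theorem add_last_le_add {f : Fin n → ℝ} (hf : Antitone f) {l l' i j : Fin n}
    (hl : l.val = n - 2) (hl' : l'.val = n - 1) (hij : i ≠ j) : f l + f l' ≤ f i + f j := by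
  have hi := i.2
  have hj := j.2
  have key : ∀ i j : Fin n, i < j → f l + f l' ≤ f i + f j := fun i j hij => by
    have hij' : i.val < j.val := hij
    exact add_le_add (hf (Fin.le_def.2 (by omega))) (hf (Fin.le_def.2 (by omega)))
  rcases lt_or_gt_of_ne hij with h | h
  · exact key i j h
  · rw [add_comm (f i)]
    exact key j i h

/-- Two extra edges with distinct larger ends cost at least as much as the two of the third graph,
with its leaves at the vertices of smallest coordinate. -/
theorem energy_add_slack_le_broom (hG : IsKTree k G) (hk : 1 ≤ k) (hanti : Antitone x)
    (h0 : ∀ i, 0 ≤ x i) {q r : Fin n × Fin n} (hq : q ∈ extraPairs k G) (hr : r ∈ extraPairs k G)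
    (hqr : q.2 ≠ r.2) {p c l l' : Fin n} (hp : p.val = k - 1) (hc : c.val = k)
    (hl : l.val = n - 2) (hl' : l'.val = n - 1) (hn : k + 3 ≤ n) :
    energy G x + 2 * ∑ j, ∑ i, (if i < j then slack k G x p c i j else 0)
      ≤ energy (broom (hubs k n) {l, l'} p c) x := by
  classical
  set D : Fin n → ℝ := fun j => (x p + x j) ^ 2 - (x c + x j) ^ 2 with hD
  have hpc : x c ≤ x p := hanti (Fin.le_def.2 (by omega))
  have hDanti : Antitone D := fun i j hij => by
    have := hanti hij
    simp only [hD]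
    nlinarith
  have hD0 : ∀ j, 0 ≤ D j := fun j => by
    have := h0 j
    have := h0 c
    simp only [hD]
    nlinarith
  have hne : q ≠ r := fun h => hqr (h ▸ rfl)
  have h1 : D l + D l' ≤ ∑ s ∈ extraPairs k G, D s.2 := by
    refine (add_last_le_add hDanti hl hl' hqr).trans ?_
    rw [← Finset.sum_pair (f := fun s : Fin n × Fin n => D s.2) hne]
    exact Finset.sum_le_sum_of_subset_of_nonneg
      (Finset.insert_subset hq (Finset.singleton_subset_iff.2 hr)) fun s _ _ => hD0 s.2
  have hll : l ≠ l' := fun h => by rw [h] at hl; omega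
  have hdata : IsBroomData (hubs k n) {l, l'} p c :=
    isBroomData_hubs hk hp hc.ge fun i hi => by
      rw [Finset.mem_insert, Finset.mem_singleton] at hi
      rcases hi with rfl | rfl
      · exact ⟨by omega, fun h => by rw [h] at hl; omega⟩
      · exact ⟨by omega, fun h => by rw [h] at hl'; omega⟩
  have h2 := energy_broom hdata x
  rw [Finset.sum_pair hll] at h2
  have h3 := hG.energy_le_kStar (p := p) (c := c) hanti h0
  have hp' : p = ⟨k - 1, by omega⟩ := Fin.ext hp
  rw [kStar_eq_broom hk (by omega) c, ← hp'] at h3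
  simp only [hD] at h1
  linarith

/-- A `k`-tree sharing the index and an antitone positive eigenvector with the third graph is a
broom. -/
theorem eq_broom_of_isPerron (hG : IsKTree k G) (hx : IsPerron G x) (hk : 1 ≤ k)
    {p c l l' : Fin n} (hp : p.val = k - 1) (hc : c.val = k)
    (hl : l.val = n - 2) (hl' : l'.val = n - 1) (hn : k + 3 ≤ n)
    (hH : IsPerron (broom (hubs k n) {l, l'} p c) x)
    (heq : signlessIndex G = signlessIndex (broom (hubs k n) {l, l'} p c))
    (hslack : ∀ i j, i < j → slack k G x p c i j = 0) :
    ∃ T, IsBroomData (hubs k n) T p c ∧ G = broom (hubs k n) T p c := by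
  classical
  have hHadj : ∀ u v, (broom (hubs k n) {l, l'} p c).Adj u v ↔ u ≠ v ∧
      ((u.val < k - 1 ∨ (u = p ∧ ¬(v = l ∨ v = l')) ∨ (u = c ∧ (v = l ∨ v = l'))) ∨
      (v.val < k - 1 ∨ (v = p ∧ ¬(u = l ∨ u = l')) ∨ (v = c ∧ (u = l ∨ u = l')))) := fun u v => by
    simp only [broom_adj, mem_hubs, Finset.mem_insert, Finset.mem_singleton]
  have hpc : p ≠ c := fun h => by rw [h] at hp; omega
  have hlp : l ≠ p := fun h => by rw [h] at hl; omega
  have hlc : l ≠ c := fun h => by rw [h] at hl; omega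
  have hlp' : l' ≠ p := fun h => by rw [h] at hl'; omega
  have hlc' : l' ≠ c := fun h => by rw [h] at hl'; omega
  -- The coordinates of the hubs exceed that of `p`, and those of the leaves are below that of `c`.
  have hdata : IsBroomData (hubs k n) {l, l'} p c :=
    isBroomData_hubs hk hp hc.ge fun i hi => by
      rw [Finset.mem_insert, Finset.mem_singleton] at hi
      rcases hi with rfl | rfl
      · exact ⟨by omega, hlc⟩
      · exact ⟨by omega, hlc'⟩
  have hhub : ∀ i : Fin n, i.val < k - 1 → x p < x i := fun i hi =>
    hdata.lt_of_mem hH (Finset.insert_nonempty _ _) (mem_hubs.2 hi)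
  have hleaf : ∀ j : Fin n, c < j → x j < x c := fun j hj => by
    have hj' : c.val < j.val := hj
    exact hdata.leaf_lt hH (Finset.insert_nonempty _ _) (by rw [mem_hubs]; omega)
      (fun h => by rw [h] at hj'; omega) hj.ne'
  -- Equality in the bounds for single pairs: missing edges start at `p`, extra edges at `c`.
  have hmiss : ∀ i j, (i, j) ∈ missingPairs k G → i = p := fun i j hij => by
    obtain ⟨h1, h2, h3⟩ := mem_missingPairs.1 hij
    have hs := hslack i j h1
    rw [slack, if_pos h2, if_neg h3, sub_eq_zero] at hs
    have hle : i.val < k - 1 ∨ i = p := by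
      rw [Fin.ext_iff]
      omega
    refine hle.resolve_left fun h => ?_
    have := hx.1 j
    have := hx.1 p
    nlinarith [hhub i h]
  have hextra : ∀ i j, (i, j) ∈ extraPairs k G → i = c := fun i j hij => by
    obtain ⟨h1, h2, h3⟩ := mem_extraPairs.1 hij
    have hs := hslack i j h1
    rw [slack, if_neg (not_lt.2 h2), if_pos h3, sub_eq_zero] at hs
    have hle : c < i ∨ i = c := by
      rw [Fin.ext_iff, Fin.lt_def]
      omega
    refine hle.resolve_left fun h => ?_
    have := hx.1 j
    have := hx.1 i
    nlinarith [hleaf i h]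
  have hhubadj : ∀ i j : Fin n, i.val < k - 1 → i ≠ j → G.Adj i j := fun i j hi hij => by
    have hip : i ≠ p := fun h => by rw [h] at hi; omega
    rcases lt_or_gt_of_ne hij with h | h
    · exact adj_of_notMem_missingPairs (by omega) h fun hm => hip (hmiss _ _ hm)
    · by_contra hn
      have h' : j.val < i.val := h
      have hm : (j, i) ∈ missingPairs k G :=
        mem_missingPairs.2 ⟨h, by omega, fun h1 => hn h1.symm⟩
      rw [hmiss _ _ hm] at h'
      omega
  -- Eigenvectors being shared, a leaf is adjacent to just one of `p` and `c`.
  have hnotboth : ∀ j : Fin n, c < j → G.Adj p j → ¬ G.Adj c j := fun j hj hpj hcj => by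
    have hsub : ∀ z, (broom (hubs k n) {l, l'} p c).Adj j z → G.Adj j z := fun z hz => by
      obtain ⟨hne, hz⟩ := (hHadj _ _).1 hz
      have hjk : ¬ j.val < k - 1 := by
        have : c.val < j.val := hj
        omega
      have hjp : j ≠ p := fun h => by
        have : c.val < j.val := hj
        rw [h] at this
        omega
      rcases hz with (h | h | h) | (h | h | h)
      · exact (hjk h).elim
      · exact (hjp h.1).elim
      · exact (hj.ne' h.1).elim
      · exact (hhubadj z j h hne.symm).symm
      · exact h.1 ▸ hpj.symm
      · exact h.1 ▸ hcj.symm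
    have h1 := hH.adj_of_adj hx heq.symm hsub hpj.symm
    have h2 := hH.adj_of_adj hx heq.symm hsub hcj.symm
    rw [hHadj] at h1 h2
    have hjp : j ≠ p := fun h => by
      have : c.val < j.val := hj
      rw [h] at this
      omega
    have hjk : ¬ j.val < k - 1 := by
      have : c.val < j.val := hj
      omega
    have : ¬ p.val < k - 1 := by omega
    have : ¬ c.val < k - 1 := by omega
    have := hj.ne'
    grind
  have hone : ∀ j : Fin n, c < j → ¬ G.Adj p j → G.Adj c j := fun j hj hpj => by
    obtain ⟨w, hw, hjw⟩ := hG.exists_adj_notMem_of_card_lt (by omega) (i := j) (A := hubs k n)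
      (by rw [card_hubs (by omega)]; omega)
    rw [mem_hubs] at hw
    have hwp : w ≠ p := fun h => hpj (h ▸ hjw.symm)
    have hwk : k ≤ w.val := by
      by_contra! h
      exact hwp (Fin.ext (by omega))
    have hj' : c.val < j.val := hj
    rcases lt_or_gt_of_ne hjw.ne with h | h
    · exact (hj.ne' (hextra j w (mem_extraPairs.2 ⟨h, by omega, hjw⟩))).elim
    · have := hextra w j (mem_extraPairs.2 ⟨h, hwk, hjw.symm⟩)
      exact this ▸ hjw.symm
  set T := Finset.univ.filter fun j : Fin n => (c, j) ∈ extraPairs k G with hT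
  have hmemT : ∀ j, j ∈ T ↔ c < j ∧ G.Adj c j := fun j => by
    rw [hT, Finset.mem_filter, mem_extraPairs]
    simp [hc]
  -- Counting edges: each extra edge `c j` compensates the missing edge `p j`.
  have hpcadj : G.Adj p c := by
    by_contra hn
    have hExT : (extraPairs k G).card ≤ T.card := by
      refine (Finset.card_le_card ?_).trans (Finset.card_image_le (f := fun j => (c, j)) (s := T))
      rintro ⟨a, b⟩ hab
      obtain rfl : a = c := hextra _ _ hab
      simpa [hT] using hab
    have hsub : (insert c T).image (Prod.mk p) ⊆ missingPairs k G := by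
      intro q hq
      obtain ⟨j, hj, rfl⟩ := Finset.mem_image.1 hq
      have hplt : p < c := Fin.lt_def.2 (by omega)
      rcases Finset.mem_insert.1 hj with rfl | hj
      · exact mem_missingPairs.2 ⟨hplt, by omega, hn⟩
      · obtain ⟨h1, h2⟩ := (hmemT j).1 hj
        exact mem_missingPairs.2 ⟨hplt.trans h1, by omega, fun h => hnotboth j h1 h h2⟩
    have := Finset.card_le_card hsub
    rw [Finset.card_image_of_injective _ (Prod.mk_right_injective p),
      Finset.card_insert_of_notMem (fun h => ((hmemT c).1 h).1.ne rfl),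
      hG.card_missingPairs] at this
    omega
  refine ⟨T, isBroomData_hubs hk hp hc.ge fun j hj => ?_, ext_of_lt fun u v huv => ?_⟩
  · have h1 := ((hmemT j).1 hj).1
    have h2 : c.val < j.val := h1
    exact ⟨by omega, h1.ne'⟩
  · have huv' : u.val < v.val := huv
    simp only [broom_adj, mem_hubs, hmemT]
    rcases lt_trichotomy u.val (k - 1) with hu | hu | hu
    · simp [hhubadj u v hu huv.ne, huv.ne, hu]
    · obtain rfl : u = p := Fin.ext (by omega)
      have hv : ¬ v.val < k - 1 := by omega
      rcases eq_or_ne v c with rfl | hvc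
      · simp [hpcadj, hpc]
      · have hcv : c < v := by
          have := Fin.val_ne_of_ne hvc
          exact Fin.lt_def.2 (by omega)
        have h1 := hnotboth v hcv
        have h2 := hone v hcv
        have h3 : G.Adj u v ↔ ¬ G.Adj c v := ⟨h1, fun h => by_contra fun h' => h (h2 h')⟩
        simp [h3, hu, hv, huv.ne, huv.ne', hpc, hvc, hcv]
    · have h1 : ¬ u.val < k - 1 := by omega
      have h2 : ¬ v.val < k - 1 := by omega
      have h3 : v ≠ p := fun h => by rw [h] at huv'; omega
      have h4 : u ≠ p := fun h => by rw [h] at hu; omega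
      have h5 : v ≠ c := fun h => by rw [h] at huv'; omega
      have h6 : G.Adj u v ↔ u = c ∧ G.Adj c v := by
        refine ⟨fun h => ?_, fun h => h.1 ▸ h.2⟩
        have := hextra u v (mem_extraPairs.2 ⟨huv, by omega, h⟩)
        exact ⟨this, this ▸ h⟩
      rw [h6]
      have h7 : u = c → c < v := fun h => h ▸ huv
      simp only [ne_eq, huv.ne, not_false_eq_true, h1, h2, h3, h4, h5, false_and, or_false,
        false_or, true_and]
      exact ⟨fun h => ⟨h.1, h7 h.1, h.2⟩, fun h => ⟨h.1, h.2.2⟩⟩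

end TwoEnds

/-! ### Comparison with the third graph -/

section Sorting

/-- Every `k`-tree on `n` vertices is isomorphic to one on `Fin n` whose positive eigenvector is
antitone. -/
theorem exists_sorted {V : Type u} [Fintype V] {n k : ℕ} (hk : 1 ≤ k) (hn : k + 1 ≤ n)
    (hV : Fintype.card V = n) {G : SimpleGraph V} (hG : IsKTree k G) :
    ∃ (H : SimpleGraph (Fin n)) (x : Fin n → ℝ), Nonempty (G ≃g H) ∧ IsPerron H x ∧ Antitone x := by
  have : Nonempty V := Fintype.card_pos_iff.1 (by omega)
  have : Nonempty (Fin n) := ⟨⟨0, by omega⟩⟩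
  obtain ⟨y, hy⟩ := exists_isPerron G (hG.preconnected hk)
  let e := Fintype.equivFinOfCardEq hV
  let f : Fin n → ℝ := fun i => -y (e.symm i)
  let s : Fin n ≃ V := (Tuple.sort f).trans e.symm
  let iso : G.comap s ≃g G := SimpleGraph.Iso.comap s G
  refine ⟨G.comap s, y ∘ iso, ⟨iso.symm⟩,
    hy.comp_iso iso (iso.preconnected_iff.2 (hG.preconnected hk)), fun i j hij => ?_⟩
  have := Tuple.monotone_sort f hij
  exact neg_le_neg_iff.1 this

end Sorting

/-- The comparison for a sorted `k`-tree that is neither the `k`-star nor the second graph. -/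
theorem signlessIndex_le_graphG2 {k n : ℕ} (hk : 1 ≤ k) (hn : k + 1 ≤ n)
    {G : SimpleGraph (Fin n)} (hG : IsKTree k G) {x : Fin n → ℝ} (hx : IsPerron G x)
    (hanti : Antitone x) (hS : ¬ Nonempty (G ≃g kStar k n))
    (h1 : ¬ Nonempty (G ≃g graphG1 k n)) :
    signlessIndex G ≤ signlessIndex (graphG2 k n) ∧
      (signlessIndex G = signlessIndex (graphG2 k n) → Nonempty (G ≃g graphG2 k n)) := by
  classical
  have : Nonempty (Fin n) := ⟨⟨0, by omega⟩⟩
  obtain ⟨q, hq⟩ : (extraPairs k G).Nonempty := by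
    rw [Finset.nonempty_iff_ne_empty]
    intro h
    rw [← eq_kStar_of_extraPairs_eq_empty hG h] at hS
    exact hS ⟨SimpleGraph.Iso.refl⟩
  obtain ⟨r, hr, hrq⟩ : ∃ r ∈ extraPairs k G, r.2 ≠ q.2 := by
    by_contra! hall
    exact h1 (iso_graphG1_of_extraPairs_eq_singleton hk hG hx hanti
      (extraPairs_eq_singleton hG hx hanti hq hall))
  have hn3 : k + 3 ≤ n := by
    obtain ⟨hq1, hq2, -⟩ := mem_extraPairs.1 hq
    obtain ⟨hr1, hr2, -⟩ := mem_extraPairs.1 hr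
    have := Fin.val_ne_of_ne hrq
    have := q.2.2
    have := r.2.2
    rw [Fin.lt_def] at hq1 hr1
    omega
  let p : Fin n := ⟨k - 1, by omega⟩
  let c : Fin n := ⟨k, by omega⟩
  let l : Fin n := ⟨n - 2, by omega⟩
  let l' : Fin n := ⟨n - 1, by omega⟩
  have hll : l ≠ l' := fun h => by
    have := congrArg Fin.val h
    simp only [l, l'] at this
    omega
  have hdata : IsBroomData (hubs k n) {l, l'} p c := isBroomData_hubs hk rfl le_rfl fun i hi => by
    rw [Finset.mem_insert, Finset.mem_singleton] at hi
    simp only [l, l', c, Fin.ext_iff, ne_eq] at hi ⊢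
    omega
  have hdata2 : IsBroomData (hubs k n) {⟨k, by omega⟩, ⟨k + 2, by omega⟩} ⟨k - 1, by omega⟩
      ⟨k + 1, by omega⟩ := isBroomData_hubs hk rfl (Nat.le_succ k) fun i hi => by
    rw [Finset.mem_insert, Finset.mem_singleton] at hi
    simp only [Fin.ext_iff, ne_eq] at hi ⊢
    omega
  obtain ⟨e⟩ : Nonempty (broom (hubs k n) {l, l'} p c ≃g graphG2 k n) := by
    rw [graphG2_eq_broom hk hn3]
    refine nonempty_broom_iso hdata hdata2 rfl rfl ?_
    rw [Finset.card_pair hll, Finset.card_pair (by simp [Fin.ext_iff])]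
  rw [← signlessIndex_eq_of_iso e hdata.preconnected]
  have hslack0 : ∀ j i, 0 ≤ if i < j then slack k G x p c i j else 0 := fun j i => by
    split_ifs
    · exact slack_nonneg (p := p) (c := c) rfl rfl hanti (fun i => (hx.1 i).le) i j
    · exact le_rfl
  have hE := energy_add_slack_le_broom hG hk hanti (fun i => (hx.1 i).le) hq hr hrq.symm
    (p := p) (c := c) (l := l) (l' := l') rfl rfl rfl rfl hn3
  have hsum0 : 0 ≤ ∑ j, ∑ i, (if i < j then slack k G x p c i j else 0) :=
    Finset.sum_nonneg fun j _ => Finset.sum_nonneg fun i _ => hslack0 j i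
  have hle : energy G x ≤ energy (broom (hubs k n) {l, l'} p c) x := by linarith
  refine ⟨hx.signlessIndex_le hle, fun heq => ?_⟩
  obtain ⟨hH, hEeq⟩ := hx.of_energy_le hle heq
  have hsum : ∑ j, ∑ i, (if i < j then slack k G x p c i j else 0) = 0 := by linarith
  rw [Finset.sum_eq_zero_iff_of_nonneg fun j _ => Finset.sum_nonneg fun i _ => hslack0 j i] at hsum
  obtain ⟨T, hT, rfl⟩ := eq_broom_of_isPerron hG hx hk rfl rfl rfl rfl hn3 hH heq
    fun i j hij => by
      have h := hsum j (Finset.mem_univ j)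
      rw [Finset.sum_eq_zero_iff_of_nonneg fun i _ => hslack0 j i] at h
      simpa [hij] using h i (Finset.mem_univ i)
  -- A broom with the index of the third graph, but not isomorphic to the first two graphs.
  have hiso : ∀ {S : Finset (Fin n)} {b d : Fin n}, IsBroomData (hubs k n) S b d →
      S.card = T.card ∨ S.card = (otherLeaves (hubs k n) T p c).card →
      Nonempty (broom (hubs k n) T p c ≃g broom (hubs k n) S b d) := by
    rintro S b d hSd (h | h)
    · exact nonempty_broom_iso hT hSd rfl rfl h.symm
    · rw [← broom_swap hT]
      exact nonempty_broom_iso hT.swap hSd rfl rfl h.symm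
  rw [kStar_eq_broom hk (by omega) ⟨k + 1, by omega⟩] at hS
  rw [graphG1_eq_broom hk (by omega)] at h1
  rw [graphG2_eq_broom hk hn3]
  by_contra h2
  have hS' := mt (hiso (hdata2.mono (Finset.empty_subset _))) hS
  have h1' := mt (hiso (hdata2.mono (by simp))) h1
  have h2' := mt (hiso hdata2) h2
  rw [Finset.card_empty] at hS'
  rw [Finset.card_singleton] at h1'
  rw [Finset.card_pair (by simp [Fin.ext_iff])] at h2'
  refine (hT.signlessIndex_lt hdata rfl ?_ ?_).ne heq
  all_goals
    rw [Finset.card_pair hll]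
    omega

end KTreeIndex

open KTreeIndex
theorem theorem2p7 (k n : ℕ) (hk : 1 ≤ k) (hn : k + 1 ≤ n) :
    (∀ (V : Type u) [Fintype V] (G : SimpleGraph V), Fintype.card V = n →
      IsKTree k G →
      ¬ Nonempty (G ≃g kStar k n) →
      ¬ Nonempty (G ≃g graphG1 k n) →
      signlessIndex G ≤ signlessIndex (graphG2 k n) ∧
      (signlessIndex G = signlessIndex (graphG2 k n) ↔
        Nonempty (G ≃g graphG2 k n))) ∧
    (k + 5 ≤ n →
      IsKTree k (kStar k n) ∧
      IsKTree k (graphG1 k n) ∧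
      IsKTree k (graphG2 k n) ∧
      ¬ Nonempty (graphG2 k n ≃g kStar k n) ∧
      ¬ Nonempty (graphG2 k n ≃g graphG1 k n) ∧
      signlessIndex (graphG2 k n) <
        signlessIndex (graphG1 k n) ∧
      signlessIndex (graphG1 k n) <
        signlessIndex (kStar k n)) := by
  have : Nonempty (Fin n) := ⟨⟨0, by omega⟩⟩
  refine ⟨fun V _ G hV hG hS h1 => ?_, fun hn5 => ?_⟩
  · have : Nonempty V := Fintype.card_pos_iff.1 (by omega)
    obtain ⟨H, x, ⟨e⟩, hx, hanti⟩ := exists_sorted hk hn hV hG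
    have hindex := signlessIndex_eq_of_iso e (hG.preconnected hk)
    obtain ⟨hle, heq⟩ := signlessIndex_le_graphG2 hk hn (hG.of_iso e) hx hanti
      (fun ⟨f⟩ => hS ⟨e.trans f⟩) (fun ⟨f⟩ => h1 ⟨e.trans f⟩)
    refine ⟨hindex.trans_le hle, fun h => ?_, fun ⟨f⟩ =>
      signlessIndex_eq_of_iso f (hG.preconnected hk)⟩
    obtain ⟨f⟩ := heq (hindex.symm.trans h)
    exact ⟨e.trans f⟩
  · have h2 : IsBroomData (hubs k n) {⟨k, by omega⟩, ⟨k + 2, by omega⟩} ⟨k - 1, by omega⟩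
        ⟨k + 1, by omega⟩ := isBroomData_hubs hk rfl (Nat.le_succ k) fun i hi => by
      rw [Finset.mem_insert, Finset.mem_singleton] at hi
      simp only [Fin.ext_iff, ne_eq] at hi ⊢
      omega
    have h1 := h2.mono (T' := {⟨k, by omega⟩}) (by simp)
    have h0 := h2.mono (Finset.empty_subset _)
    have hcard1 := h1.card_otherLeaves
    have hcard2 := h2.card_otherLeaves
    have hpair : (({⟨k, by omega⟩, ⟨k + 2, by omega⟩} : Finset (Fin n))).card = 2 :=
      Finset.card_pair (by simp [Fin.ext_iff])
    rw [hpair, card_hubs (by omega), Fintype.card_fin] at hcard2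
    rw [Finset.card_singleton, card_hubs (by omega), Fintype.card_fin] at hcard1
    have hA : (hubs k n).card + 1 = k := by
      rw [card_hubs (by omega)]
      omega
    have h21 := h2.signlessIndex_lt h1 rfl (by simp [hpair])
      (by rw [Finset.card_singleton]; omega)
    have h10 := h1.signlessIndex_lt h0 rfl (by simp) (by rw [Finset.card_empty]; omega)
    rw [kStar_eq_broom hk hn ⟨k + 1, by omega⟩, graphG1_eq_broom hk (by omega),
      graphG2_eq_broom hk (by omega)]
    exact ⟨isKTree_broom _ rfl h0 hA, isKTree_broom _ rfl h1 hA, isKTree_broom _ rfl h2 hA,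
      fun ⟨e⟩ => (h21.trans h10).ne (signlessIndex_eq_of_iso e h2.preconnected),
      fun ⟨e⟩ => h21.ne (signlessIndex_eq_of_iso e h2.preconnected), h21, h10⟩
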